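/- **Model.** Let $G=(V,E)$ be a finite simple undirected graph with $n$ vertices, viewed as a network in which each undirected edge is a pair of opposite directed edges; let $m$ be the number of directed edges. In a deterministic *$T$-round protocol* $\pi$ on $G$, each party $v\in V$ has an input; in each of $T$ synchronous rounds it sends one bit to each of its neighbors, determined by its own input and the bits it has received in earlier rounds; at the end it gives an output, determined by its input and all the bits it has received. (Private coins of the parties of $\pi$, if any, are regarded as part of their inputs.) A *shared-randomness protocol* is one in which, in addition, all parties see a common uniformly random element of some finite set. A *shared-randomness compiler* on $G$ assigns to each protocol $\pi$ on $G$ (with any number of rounds and any sets of inputs and outputs) a shared-randomness protocol $C(\pi)$ on $G$ in which the parties have the same inputs and the same sets of possible outputs. An *adversary* may flip transmitted bits. In each round its choice of the bits to flip may depend on the inputs of all parties and on all bits sent on all edges up to and including that round, but not on the common randomness. It *stays within bit error rate $\rho$* if in every execution at most a fraction $\rho$ of all the transmitted bits (one per directed edge per round, i.e. $m\tilde T$ bits if there are $\tilde T$ rounds) is flipped. $C(\pi)$ *tolerates bit error rate $\rho$ with failure probability $\delta$* if, for all inputs and every adversary that stays within bit error rate $\rho$, the probability over the common randomness that some party's output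 differs from its output in the noiseless execution of $\pi$ is at most $\delta$. **Theorem.** For every $\epsilon>0$ there exist constants $\rho_0,c,K>0$, depending only on $\epsilon$, such that the following holds. Let $G$ be an undirected graph on $n$ vertices in which every two adjacent vertices have at least $\epsilon n$ common neighbors. Then there is a shared-randomness compiler $C$ on $G$ such that for every $T\ge 0$ and every $T$-round protocol $\pi$ on $G$, the protocol $C(\pi)$ has round complexity at most $K\,T\log n$ and tolerates the bit error rate $\rho_0/n$ with failure probability at most $e^{-cT}$. -/

import Mathlib

namespace NoisyNetwork

/-- A deterministic `T`-round synchronous protocol on the undirected (i.e. bidirected) network `G`.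
Party `v` has an input in `X v` and must give an output in `Y v`.
In every round `t = 0, …, T - 1` each party sends one bit to each of its neighbours; these bits
depend only on the party's own input and on the bits it received in the rounds before `t`.
After the last round each party computes its output from its input and all bits it received.
(Private coins of a party, if any, are regarded as a part of its input.) -/
structure Protocol {V : Type*} (G : SimpleGraph V) (X Y : V → Type*) (T : ℕ) where
  /-- `send v a t h u` is the bit that `v`, with input `a`, sends to its neighbour `u` in round `t`,
  where `h s w` is the bit that `v` received from its neighbour `w` in round `s < t`. -/
  send : ∀ v, X v → (t : ℕ) → (Fin t → G.neighborSet v → Bool) → G.neighborSet v → Bool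
  /-- `output v a h` is the output of `v` with input `a` after receiving `h` in the `T` rounds. -/
  output : ∀ v, X v → (Fin T → G.neighborSet v → Bool) → Y v

/-- An adaptive adversary. `A x t h d` says whether the bit sent along the directed edge `d` in round
`t` is flipped. The decision may depend on the inputs `x` of all the parties and on the whole
history `h` of the bits sent on all edges in the rounds `0, …, t` (the present round included). -/
abbrev Adversary {V : Type*} (G : SimpleGraph V) (X : V → Type*) : Type _ :=
  (∀ v, X v) → (t : ℕ) → (Fin (t + 1) → G.Dart → Bool) → G.Dart → Bool

/-- The adversary that never flips a bit. -/
def noiseless {V : Type*} (G : SimpleGraph V) (X : V → Type*) : Adversary G X :=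
  fun _ _ _ _ => false

/-- The part of the bits `r` arriving along all directed edges that arrives at the party `v`. -/
def inbox {V : Type*} {G : SimpleGraph V} (v : V) (r : G.Dart → Bool) : G.neighborSet v → Bool :=
  fun u => r ⟨(u.1, v), G.adj_symm u.2⟩

namespace Protocol

variable {V : Type*} {G : SimpleGraph V} {X Y : V → Type*} {T : ℕ}

/-- The bits sent on all directed edges in round `t`, given the bits `r` received on all directed
edges in the rounds before `t`. -/
def sendAll (π : Protocol G X Y T) (x : ∀ v, X v) (t : ℕ) (r : Fin t → G.Dart → Bool) :
    G.Dart → Bool :=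
  fun d => π.send d.fst (x d.fst) t (fun s => inbox d.fst (r s)) ⟨d.snd, d.adj⟩

/-- The execution of `π` on the inputs `x` in the presence of the adversary `A`:
the pair (bits sent, bits received) on all directed edges in round `t`. -/
def exec (π : Protocol G X Y T) (A : Adversary G X) (x : ∀ v, X v) (t : ℕ) :
    (G.Dart → Bool) × (G.Dart → Bool) :=
  let past : Fin t → (G.Dart → Bool) × (G.Dart → Bool) := fun s => exec π A x s.1
  let now : G.Dart → Bool := π.sendAll x t (fun s => (past s).2)
  let flip : G.Dart → Bool :=
    A x t (Fin.snoc (α := fun _ => G.Dart → Bool) (fun s => (past s).1) now)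
  (now, fun d => xor (now d) (flip d))
termination_by t
decreasing_by exact s.2

/-- The bits sent in round `t`. -/
def sent (π : Protocol G X Y T) (A : Adversary G X) (x : ∀ v, X v) (t : ℕ) : G.Dart → Bool :=
  (π.exec A x t).1

/-- The bits received in round `t`. -/
def received (π : Protocol G X Y T) (A : Adversary G X) (x : ∀ v, X v) (t : ℕ) : G.Dart → Bool :=
  (π.exec A x t).2

/-- The outputs of the parties in the presence of the adversary `A`. -/
def result (π : Protocol G X Y T) (A : Adversary G X) (x : ∀ v, X v) : ∀ v, Y v :=
  fun v => π.output v (x v) (fun s => inbox v (π.received A x s))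

theorem sent_eq (π : Protocol G X Y T) (A : Adversary G X) (x : ∀ v, X v) (t : ℕ) :
    π.sent A x t = π.sendAll x t (fun s => π.received A x s) := by
  unfold sent
  rw [exec]
  rfl

theorem received_eq (π : Protocol G X Y T) (A : Adversary G X) (x : ∀ v, X v) (t : ℕ)
    (d : G.Dart) :
    π.received A x t d =
      xor (π.sent A x t d) (A x t (fun s => π.sent A x s) d) := by
  have h : (fun s : Fin (t + 1) => π.sent A x s) =
      Fin.snoc (α := fun _ => G.Dart → Bool) (fun s : Fin t => π.sent A x s)
        (π.sendAll x t (fun s => π.received A x s)) := by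
    rw [← sent_eq]
    funext s
    refine Fin.lastCases ?_ (fun i => ?_) s <;> simp
  rw [h, sent_eq]
  conv_lhs => unfold received; rw [exec]
  rfl

/-- The number of bit errors in an execution: the number of pairs of a round `t < T` and a directed
edge on which the received bit is different from the bit sent. -/
def errorCount [Fintype V] [DecidableEq V] [DecidableRel G.Adj] (π : Protocol G X Y T)
    (A : Adversary G X) (x : ∀ v, X v) : ℕ :=
  ∑ t ∈ Finset.range T,
    (Finset.univ.filter (fun d : G.Dart => π.received A x t d ≠ π.sent A x t d)).card

end Protocol

/-- A shared-randomness protocol: all the parties have access to a common uniformly random element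
of the finite set `Seed` and, given its value, follow a deterministic protocol. The value is not
available to an adversary. -/
structure SharedProtocol {V : Type*} (G : SimpleGraph V) (X Y : V → Type*) where
  /-- the round complexity -/
  rounds : ℕ
  Seed : Type
  [fintypeSeed : Fintype Seed]
  [nonemptySeed : Nonempty Seed]
  /-- the behaviour of the parties for each value of the common random string -/
  run : Seed → Protocol G X Y rounds

attribute [instance] SharedProtocol.fintypeSeed SharedProtocol.nonemptySeed

namespace SharedProtocol

variable {V : Type*} {G : SimpleGraph V} {X Y : V → Type*} {T : ℕ}

/-- On the inputs `x`, the adversary `A` stays within the bit error rate `ρ`: whatever the common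
random string is, the number of bit errors is at most `ρ` times the total number of bits
transmitted (one bit on every directed edge in every round). -/
def WithinRate [Fintype V] [DecidableEq V] [DecidableRel G.Adj] (σ : SharedProtocol G X Y)
    (A : Adversary G X) (x : ∀ v, X v) (ρ : ℝ) : Prop :=
  ∀ ω : σ.Seed, ((σ.run ω).errorCount A x : ℝ) ≤ ρ * (Fintype.card G.Dart * σ.rounds)

open Classical in
/-- The probability, over the common random string, that on the inputs `x` and in the presence of
the adversary `A` some party's output in `σ` is not its output in a noiseless execution of `π`. -/
noncomputable def failureProb (σ : SharedProtocol G X Y) (π : Protocol G X Y T)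
    (A : Adversary G X) (x : ∀ v, X v) : ℝ :=
  ((Finset.univ.filter (fun ω : σ.Seed =>
      (σ.run ω).result A x ≠ π.result (noiseless G X) x)).card : ℝ) / Fintype.card σ.Seed

/-- As a simulation of `π`, the protocol `σ` tolerates the bit error rate `ρ` with failure
probability at most `δ`, for all inputs and all adversaries that stay within that rate. -/
def Tolerates [Fintype V] [DecidableEq V] [DecidableRel G.Adj] (σ : SharedProtocol G X Y)
    (π : Protocol G X Y T) (ρ δ : ℝ) : Prop :=
  ∀ (A : Adversary G X) (x : ∀ v, X v), σ.WithinRate A x ρ → σ.failureProb π A x ≤ δ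

end SharedProtocol

/-- A shared-randomness compiler for protocols on `G`: it takes a protocol on `G`, with any number
of rounds and any input and output sets, to a shared-randomness protocol on `G` with the same input
and output sets. -/
abbrev SharedCompiler.{w, a, b} {V : Type w} (G : SimpleGraph V) : Type _ :=
  ∀ (X : V → Type a) (Y : V → Type b) (T : ℕ), Protocol G X Y T → SharedProtocol G X Y

end NoisyNetwork

/-! The compiler is a composition of three layers.

The inner layer is an interactive code for which a round is lost as soon as one of its bits, on any
edge, is wrong. Each party keeps a stack of simulated rounds of `π` and tells each neighbour its
stack moves in a tree code over a fixed field. The potential is the least, over all parties, of the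
length of the correct part of the stack minus that of the wrong part. It rises in every step in
which all decodings are right (`HasLevel.nextMove`) and drops by at most one in any other step.
Wrong decodings need dense windows of corruption (`decode_error`), so they occur in at most four
times as many steps as are corrupted (`card_dense_windows`). Hence `Protocol.coded_output`: `68 T`
rounds suffice if at most `T / 16` of them are corrupted.

A rate of order `1 / n` still leaves the adversary up to order `n` flips per round. The middle layer
therefore sends each bit `L`, of order `log n / ε`, times along two-hop paths and takes a majority.
A common random shift `s` sends the pair `u, v` through the vertex numbered `s - φ u - φ v`, so in
each hop a directed edge serves a single pair. Adjacent vertices have at least `ε n` usable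
intermediate vertices. A block with at most `ε n L / 6` flips thus spoils some majority only with
probability at most `n ^ 2 * exp (-ε L / 4)` (`card_flawed_le`), and the error budget admits few
blocks with more flips.

That estimate needs flips that do not depend on the shifts, while the adversary sees the transmitted
bits. The outer layer masks them by one-time pads. For fixed shifts the map from pads to transmitted
bits is injective (`Protocol.pad_eq_of_sent_eq`), so seeds may be counted as pairs of shifts and
transcript. The flips depend on the transcript alone, and each transcript is treated separately. -/

namespace NoisyNetwork

/-- Exponential Markov inequality for the counting measure on a finite product. -/
theorem mul_card_le_prod_sum {ι Ω : Type*} [Fintype ι] [DecidableEq ι] [Fintype Ω]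
    (S : Finset (ι → Ω)) (φ : ι → Ω → ℝ) (hφ : ∀ i ω, 0 ≤ φ i ω) (a : ℝ)
    (h : ∀ f ∈ S, a ≤ ∏ i, φ i (f i)) : a * S.card ≤ ∏ i, ∑ ω, φ i ω := by
  classical
  rw [Finset.prod_univ_sum, Fintype.piFinset_univ]
  calc a * S.card = ∑ _f ∈ S, a := by rw [Finset.sum_const, nsmul_eq_mul, mul_comm]
    _ ≤ ∑ f ∈ S, ∏ i, φ i (f i) := Finset.sum_le_sum h
    _ ≤ ∑ f : ι → Ω, ∏ i, φ i (f i) :=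
      Finset.sum_le_sum_of_subset_of_nonneg (Finset.subset_univ S)
        (fun f _ _ => Finset.prod_nonneg (fun i _ => hφ i _))

/-! ### Tree codes: existence, decoding, and the number of decoding errors. -/

section TreeCode

variable {F : Type*} [Field F]

/-- The `j`-th coefficient of the product of the power series `g` and `σ`. -/
def conv (g σ : ℕ → F) (j : ℕ) : F := ∑ i ∈ Finset.range (j + 1), g (j - i) * σ i

theorem conv_congr {g g' σ σ' : ℕ → F} {j : ℕ} (hg : ∀ i ≤ j, g i = g' i)
    (hσ : ∀ i ≤ j, σ i = σ' i) : conv g σ j = conv g' σ' j := by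
  refine Finset.sum_congr rfl fun i hi => ?_
  rw [Finset.mem_range] at hi
  rw [hg _ (Nat.sub_le _ _), hσ i (by omega)]

/-- The system is triangular with diagonal entry `δ 0`. In the random choice of a tree code this
makes the code difference of two words as random as the coefficients `g`. -/
theorem eq_of_conv_eq {g g' δ : ℕ → F} (hδ : δ 0 ≠ 0) {N : ℕ}
    (h : ∀ j < N, conv g δ j = conv g' δ j) : ∀ j < N, g j = g' j := by
  intro j
  induction j using Nat.strong_induction_on with
  | _ j ih =>
    intro hj
    have h1 := h j hj
    unfold conv at h1
    rw [Finset.sum_range_succ', Finset.sum_range_succ'] at h1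
    have h2 : ∑ k ∈ Finset.range j, g (j - (k + 1)) * δ (k + 1)
        = ∑ k ∈ Finset.range j, g' (j - (k + 1)) * δ (k + 1) := by
      refine Finset.sum_congr rfl fun k hk => ?_
      rw [Finset.mem_range] at hk
      rw [ih _ (by omega) (by omega)]
    rw [h2] at h1
    simpa [hδ] using h1

/-- A sequence of finite length, continued by zeros. -/
def zeroExtend {N : ℕ} (g : Fin N → F) (i : ℕ) : F := if h : i < N then g ⟨i, h⟩ else 0

/-- Chernoff bound with weight `65536 = 256 ^ 2` for each zero among the first `ℓ` entries. Half of
them being zero gives weight at least `256 ^ ℓ`, whereas each entry has mean weight at most `2`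
because the field has at least `65536` elements. -/
theorem card_many_zeros [Fintype F] [DecidableEq F] (hF : 65536 ≤ Fintype.card F) {N ℓ : ℕ}
    (hℓ : ℓ ≤ N) :
    (128 : ℝ) ^ ℓ * (Finset.univ.filter (fun y : Fin N → F =>
      ℓ ≤ 2 * (Finset.univ.filter (fun k : Fin N => k.1 < ℓ ∧ y k = 0)).card)).card
      ≤ (Fintype.card F : ℝ) ^ N := by
  set S := Finset.univ.filter (fun y : Fin N → F =>
      ℓ ≤ 2 * (Finset.univ.filter (fun k : Fin N => k.1 < ℓ ∧ y k = 0)).card)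
  have hq : (65536 : ℝ) ≤ Fintype.card F := by exact_mod_cast hF
  have key := mul_card_le_prod_sum S (fun k a => if k.1 < ℓ ∧ a = 0 then (65536 : ℝ) else 1)
    (fun k a => by split_ifs <;> norm_num) ((256 : ℝ) ^ ℓ) (by
      intro y hy
      rw [Finset.prod_ite, Finset.prod_const, Finset.prod_const_one, mul_one]
      have hy' := (Finset.mem_filter.1 hy).2
      calc (256 : ℝ) ^ ℓ ≤ 256 ^ (2 * (Finset.univ.filter
            (fun k : Fin N => k.1 < ℓ ∧ y k = 0)).card) :=
            pow_le_pow_right₀ (by norm_num) hy'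
        _ = _ := by rw [pow_mul]; norm_num)
  have hprod : ∏ k : Fin N, ∑ a : F, (if k.1 < ℓ ∧ a = 0 then (65536 : ℝ) else 1)
      ≤ (Fintype.card F : ℝ) ^ N * 2 ^ ℓ := by
    calc ∏ k : Fin N, ∑ a : F, (if k.1 < ℓ ∧ a = 0 then (65536 : ℝ) else 1)
        ≤ ∏ k : Fin N, ((Fintype.card F : ℝ) * if k.1 < ℓ then 2 else 1) := by
          refine Finset.prod_le_prod
            (fun k _ => Finset.sum_nonneg fun a _ => by split_ifs <;> norm_num) fun k _ => ?_
          by_cases hk : k.1 < ℓ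
          · have : ∀ a : F, (if k.1 < ℓ ∧ a = 0 then (65536 : ℝ) else 1)
                = 1 + if a = 0 then 65535 else 0 := by
              intro a; by_cases ha : a = 0 <;> simp [hk, ha]; norm_num
            rw [Finset.sum_congr rfl (fun a _ => this a), Finset.sum_add_distrib]
            simp [hk]
            linarith
          · simp [hk]
      _ = _ := by
          rw [Finset.prod_mul_distrib, Finset.prod_const, Finset.prod_ite, Finset.prod_const,
            Finset.prod_const_one, mul_one, Finset.card_univ, Fintype.card_fin]
          congr 2
          have : (Finset.univ.filter (fun k : Fin N => k.1 < ℓ)).card = ℓ := by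
            rw [Fin.card_filter_val_lt, min_eq_right hℓ]
          rw [this]
  have h2 : (2 : ℝ) ^ ℓ * ((128 : ℝ) ^ ℓ * S.card) ≤ 2 ^ ℓ * (Fintype.card F : ℝ) ^ N := by
    calc (2 : ℝ) ^ ℓ * ((128 : ℝ) ^ ℓ * S.card) = 256 ^ ℓ * S.card := by
          rw [← mul_assoc, ← mul_pow]; norm_num
      _ ≤ _ := key.trans hprod
      _ = _ := mul_comm _ _
  exact le_of_mul_le_mul_left h2 (by positivity)

/-- Existence of a linear time-invariant tree code of distance greater than `1/2`. -/
theorem exists_treeCode [Fintype F] (hF : 65536 ≤ Fintype.card F) {A : Type*} [Fintype A]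
    (hA : Fintype.card A = 4) (ι : A → F) (N : ℕ) :
    ∃ g : ℕ → F, ∀ σ τ : ℕ → A, ι (σ 0) ≠ ι (τ 0) → ∀ ℓ, 1 ≤ ℓ → ℓ ≤ N →
      ∀ S ⊆ Finset.range ℓ, (∀ k ∈ S, conv g (fun i => ι (σ i) - ι (τ i)) k = 0) →
        2 * S.card < ℓ := by
  classical
  let δ (ℓ : ℕ) (d : Fin ℓ → A × A) : ℕ → F := zeroExtend (fun i => ι (d i).1 - ι (d i).2)
  let many (ℓ : ℕ) : Finset (Fin N → F) := Finset.univ.filter (fun y : Fin N → F =>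
      ℓ ≤ 2 * (Finset.univ.filter (fun k : Fin N => k.1 < ℓ ∧ y k = 0)).card)
  let bad (ℓ : ℕ) (d : Fin ℓ → A × A) : Finset (Fin N → F) :=
    Finset.univ.filter (fun g => δ ℓ d 0 ≠ 0 ∧
      (fun k : Fin N => conv (zeroExtend g) (δ ℓ d) k) ∈ many ℓ)
  -- For `δ 0 ≠ 0` the map from `g` to its product with `δ` is injective, so bad coefficients are no
  -- more numerous than words with many zeros.
  have hbad : ∀ ℓ d, (bad ℓ d).card ≤ (many ℓ).card := by
    intro ℓ d
    by_cases h0 : δ ℓ d 0 = 0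
    · have : bad ℓ d = ∅ := by
        apply Finset.filter_eq_empty_iff.2
        intro g _ h; exact h.1 h0
      simp [this]
    · refine Finset.card_le_card_of_injOn (fun g => fun k : Fin N => conv (zeroExtend g) (δ ℓ d) k)
        (fun g hg => (Finset.mem_filter.1 hg).2.2) ?_
      intro g _ g' _ hgg
      have := eq_of_conv_eq (g := zeroExtend g) (g' := zeroExtend g') h0 (N := N)
        (fun j hj => congrFun hgg ⟨j, hj⟩)
      funext k
      have hk := this k.1 k.2
      simpa [zeroExtend] using hk
  have hq : (0 : ℝ) < Fintype.card F := by
    have : 0 < Fintype.card F := by omega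
    exact_mod_cast this
  let allBad : Finset (Fin N → F) :=
    (Finset.Icc 1 N).biUnion fun ℓ => Finset.univ.biUnion fun d => bad ℓ d
  have hall : (allBad.card : ℝ) < (Fintype.card F : ℝ) ^ N := by
    -- Union bound: `16 ^ ℓ` pairs of words of length `ℓ`, each bad for a fraction at most `128 ^
    -- (-ℓ)` of the coefficients. The sum of `(1 / 8) ^ ℓ` over `ℓ ≥ 1` is below one.
    have h1 : (allBad.card : ℝ) ≤ ∑ ℓ ∈ Finset.Icc 1 N, (1 / 8 : ℝ) ^ ℓ * (Fintype.card F : ℝ) ^ N := by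
      refine (Nat.cast_le.2 Finset.card_biUnion_le).trans ?_
      rw [Nat.cast_sum]
      refine Finset.sum_le_sum fun ℓ hℓ => ?_
      have h2 : ((Finset.univ.biUnion fun d => bad ℓ d).card : ℝ) ≤ 16 ^ ℓ * (many ℓ).card := by
        have := (Finset.card_biUnion_le (s := Finset.univ) (t := fun d => bad ℓ d)).trans
          (Finset.sum_le_card_nsmul _ _ _ (fun d _ => hbad ℓ d))
        simp [Finset.card_univ, hA] at this
        exact_mod_cast this
      have h3 := card_many_zeros hF (Finset.mem_Icc.1 hℓ).2
      have h4 : (16 : ℝ) ^ ℓ = (1 / 8) ^ ℓ * 128 ^ ℓ := by rw [← mul_pow]; norm_num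
      calc _ ≤ _ := h2
        _ = (1 / 8) ^ ℓ * (128 ^ ℓ * ((many ℓ).card : ℝ)) := by rw [h4, mul_assoc]
        _ ≤ _ := by gcongr
    rw [← Finset.sum_mul] at h1
    refine h1.trans_lt ?_
    have h5 : ∑ ℓ ∈ Finset.Icc 1 N, (1 / 8 : ℝ) ^ ℓ < 1 := by
      have : Finset.Icc 1 N = Finset.Ico 1 (N + 1) := by ext; simp
      rw [this, geom_sum_Ico (by norm_num) (by omega), div_lt_iff_of_neg (by norm_num)]
      have : (0 : ℝ) < (1 / 8) ^ (N + 1) := by positivity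
      linarith
    calc _ < 1 * (Fintype.card F : ℝ) ^ N := by gcongr
      _ = _ := one_mul _
  obtain ⟨g, hg⟩ : ∃ g, g ∉ allBad := by
    by_contra! hcon
    have : allBad = Finset.univ := Finset.eq_univ_of_forall hcon
    rw [this, Finset.card_univ] at hall
    simp at hall
  refine ⟨zeroExtend g, fun σ τ h0 ℓ h1 hN S hS hz => ?_⟩
  by_contra! hcon
  apply hg
  simp only [allBad, Finset.mem_biUnion, Finset.mem_univ, true_and]
  refine ⟨ℓ, Finset.mem_Icc.2 ⟨h1, hN⟩, fun i => (σ i, τ i), ?_⟩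
  have hδ : ∀ i < ℓ, δ ℓ (fun i => (σ i, τ i)) i = ι (σ i) - ι (τ i) := by
    intro i hi; simp [δ, zeroExtend, hi]
  simp only [bad, many, Finset.mem_filter, Finset.mem_univ, true_and]
  refine ⟨by rw [hδ 0 h1]; exact sub_ne_zero.2 h0, hcon.trans ?_⟩
  gcongr
  have hlt : ∀ k ∈ S, k < N := fun k hk => (Finset.mem_range.1 (hS hk)).trans_le hN
  rw [← Finset.card_attachFin S hlt]
  apply Finset.card_le_card
  intro k hk
  rw [Finset.mem_attachFin] at hk
  have hkℓ := Finset.mem_range.1 (hS hk)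
  simp only [Finset.mem_filter, Finset.mem_univ, true_and]
  refine ⟨hkℓ, ?_⟩
  rw [← hz _ hk]
  exact conv_congr (fun _ _ => rfl) (fun i hi => hδ i (by omega))

/-- The number of positions in `s` where the encoding of `h` differs from the word `c`. -/
noncomputable def mismatches (g : ℕ → F) (c h : ℕ → F) (s : Finset ℕ) : ℕ :=
  open Classical in (s.filter (fun i => conv g h i ≠ c i)).card

/-- Minimum distance decoding of the first `j` symbols. -/
noncomputable def decode {A : Type*} [Nonempty A] (ι : A → F) (g : ℕ → F) (c : ℕ → F) (j : ℕ) :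
    ℕ → A :=
  Function.argmin (fun h : ℕ → A => mismatches g c (fun i => ι (h i)) (Finset.range j))

/-- A decoding error forces a quarter of the word, in some final window, to be corrupted. -/
theorem decode_error {A : Type*} [Nonempty A] {ι : A → F} (hι : Function.Injective ι) {g : ℕ → F}
    {N : ℕ} (hg : ∀ σ τ : ℕ → A, ι (σ 0) ≠ ι (τ 0) → ∀ ℓ, 1 ≤ ℓ → ℓ ≤ N →
      ∀ S ⊆ Finset.range ℓ, (∀ k ∈ S, conv g (fun i => ι (σ i) - ι (τ i)) k = 0) →
        2 * S.card < ℓ)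
    (σ : ℕ → A) (c : ℕ → F) (C : Finset ℕ) {j : ℕ} (hj : j ≤ N)
    (hC : ∀ i < j, i ∉ C → c i = conv g (fun i => ι (σ i)) i)
    (h : ∃ i < j, decode ι g c j i ≠ σ i) :
    ∃ a < j, j - a < 4 * (C ∩ Finset.Ico a j).card := by
  classical
  set τ := decode ι g c j with hτ
  have hmin : mismatches g c (fun i => ι (τ i)) (Finset.range j)
      ≤ mismatches g c (fun i => ι (σ i)) (Finset.range j) :=
    Function.argmin_le (fun h : ℕ → A => mismatches g c (fun i => ι (h i)) (Finset.range j)) σ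
  let a := Nat.find h
  obtain ⟨haj, hane⟩ : a < j ∧ τ a ≠ σ a := Nat.find_spec h
  have hlt : ∀ i < a, τ i = σ i := by
    intro i hi
    by_contra hne
    exact Nat.find_min h hi ⟨hi.trans haj, hne⟩
  refine ⟨a, haj, ?_⟩
  have hsplit : ∀ h : ℕ → F, mismatches g c h (Finset.range j)
      = mismatches g c h (Finset.range a) + mismatches g c h (Finset.Ico a j) := by
    intro h
    unfold mismatches
    simp only [Finset.range_eq_Ico]
    rw [← Finset.Ico_union_Ico_eq_Ico (Nat.zero_le a) haj.le,
      Finset.filter_union, Finset.card_union_of_disjoint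
      (Finset.disjoint_filter_filter (Finset.Ico_disjoint_Ico_consecutive 0 a j))]
  have heq : mismatches g c (fun i => ι (τ i)) (Finset.range a)
      = mismatches g c (fun i => ι (σ i)) (Finset.range a) := by
    unfold mismatches
    congr 1
    ext i
    simp only [Finset.mem_filter]
    refine and_congr_right fun hi => ?_
    rw [conv_congr (fun _ _ => rfl) (σ' := fun i => ι (σ i))]
    intro k hk
    rw [hlt k (hk.trans_lt (Finset.mem_range.1 hi))]
  rw [hsplit, hsplit, heq, Nat.add_le_add_iff_left] at hmin
  have hσ : mismatches g c (fun i => ι (σ i)) (Finset.Ico a j) ≤ (C ∩ Finset.Ico a j).card := by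
    refine Finset.card_le_card fun i hi => ?_
    obtain ⟨h1, h2⟩ := Finset.mem_filter.1 hi
    refine Finset.mem_inter.2 ⟨?_, h1⟩
    by_contra hiC
    exact h2 (hC i (Finset.mem_Ico.1 h1).2 hiC).symm
  let Z := (Finset.range (j - a)).filter
    (fun k => conv g (fun i => ι (τ (a + i)) - ι (σ (a + i))) k = 0)
  -- The code is time-invariant: since the two words agree before `a`, their encodings differ from
  -- `a` on as if both words started at `a`.
  have hZ : 2 * Z.card < j - a :=
    hg (fun i => τ (a + i)) (fun i => σ (a + i)) (by simpa using hι.ne hane) (j - a)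
      (by omega) (by omega) Z (Finset.filter_subset _ _) (fun k hk => (Finset.mem_filter.1 hk).2)
  have hshift : ∀ k, conv g (fun i => ι (τ (a + i)) - ι (σ (a + i))) k
      = conv g (fun i => ι (τ i)) (a + k) - conv g (fun i => ι (σ i)) (a + k) := by
    intro k
    unfold conv
    rw [← Finset.sum_sub_distrib, add_assoc, Finset.sum_range_add _ a (k + 1),
      Finset.sum_eq_zero (s := Finset.range a), zero_add]
    · refine Finset.sum_congr rfl fun i _ => ?_
      rw [mul_sub]
      congr 3 <;> omega
    · intro i hi
      simp [hlt i (Finset.mem_range.1 hi)]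
  -- At an uncorrupted position where the decoded word fits `c`, both encodings agree. As the
  -- decoded word has no more mismatches than the true one, the window has length at most `2 |C ∩
  -- window| + |Z|`, and `2 |Z|` is less than that length.
  have hcover : Finset.Ico a j ⊆ ((Finset.Ico a j).filter
      (fun i => conv g (fun i => ι (τ i)) i ≠ c i) ∪ (C ∩ Finset.Ico a j)) ∪
        Z.image (fun k => a + k) := by
    intro i hi
    obtain ⟨h1, h2⟩ := Finset.mem_Ico.1 hi
    simp only [Finset.mem_union, Finset.mem_filter, Finset.mem_inter, Finset.mem_image, hi,
      true_and, and_true]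
    by_cases hm : conv g (fun i => ι (τ i)) i = c i
    · by_cases hiC : i ∈ C
      · exact Or.inl (Or.inr hiC)
      · refine Or.inr ⟨i - a, Finset.mem_filter.2 ⟨Finset.mem_range.2 (by omega), ?_⟩, by omega⟩
        rw [hshift, show a + (i - a) = i by omega, hm, hC i h2 hiC, sub_self]
    · exact Or.inl (Or.inl hm)
  have hc := Finset.card_le_card hcover
  rw [Nat.card_Ico] at hc
  have hc2 := hc.trans (Finset.card_union_le _ _)
  have hc3 := Finset.card_union_le ((Finset.Ico a j).filter
      (fun i => conv g (fun i => ι (τ i)) i ≠ c i)) (C ∩ Finset.Ico a j)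
  have hc4 : (Z.image (fun k => a + k)).card ≤ Z.card := Finset.card_image_le
  unfold mismatches at hmin hσ
  omega

/-- The points that end a window with corruption density above a quarter are at most four times as
many as the corrupted points. -/
theorem card_dense_windows (C : Finset ℕ) (N : ℕ) (P : ℕ → Prop) [DecidablePred P]
    (hP : ∀ j, P j → ∃ a < j, j - a < 4 * (C ∩ Finset.Ico a j).card) :
    ((Finset.range N).filter P).card ≤ 4 * C.card := by
  classical
  -- Charging argument: `m` bounds the excess `4 |C ∩ [a, N)| - (N - a)` of every window ending at
  -- `N`. A corrupted point adds four units of credit and a point with `P` consumes one.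
  suffices H : ∀ N, ∃ m : ℕ, (∀ a ≤ N, 4 * (C ∩ Finset.Ico a N).card ≤ (N - a) + m) ∧
      m + ((Finset.range (N + 1)).filter P).card ≤ 4 * (C ∩ Finset.range N).card by
    obtain ⟨m, -, h⟩ := H N
    have h1 : ((Finset.range N).filter P).card ≤ ((Finset.range (N + 1)).filter P).card :=
      Finset.card_le_card (Finset.filter_subset_filter _ (Finset.range_mono (Nat.le_succ N)))
    have h2 : (C ∩ Finset.range N).card ≤ C.card := Finset.card_le_card Finset.inter_subset_left
    omega
  intro N
  induction N with
  | zero =>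
    refine ⟨0, by simp, ?_⟩
    have : ¬ P 0 := fun h => by obtain ⟨a, h, -⟩ := hP 0 h; omega
    simp [Finset.filter_singleton, this]
  | succ N ih =>
    obtain ⟨m, h1, h2⟩ := ih
    have hIco : ∀ a ≤ N, (C ∩ Finset.Ico a (N + 1)).card
        = (C ∩ Finset.Ico a N).card + if N ∈ C then 1 else 0 := by
      intro a ha
      rw [Finset.Ico_add_one_right_eq_Icc, ← Finset.Ico_insert_right ha]
      split_ifs with hN
      · rw [Finset.inter_insert_of_mem hN, Finset.card_insert_of_notMem (by simp)]
      · rw [Finset.inter_insert_of_notMem hN, add_zero]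
    have hr := hIco 0 (Nat.zero_le N)
    simp only [← Finset.range_eq_Ico] at hr
    rw [Finset.range_add_one (n := N + 1), Finset.filter_insert]
    by_cases hPN : P (N + 1)
    · rw [if_pos hPN, Finset.card_insert_of_notMem (by simp)]
      obtain ⟨a, ha, h3⟩ := hP _ hPN
      have h4 := h1 a (by omega)
      have h5 := hIco a (by omega)
      -- The dense window ending at `N + 1` makes the credit positive, so the subtraction is not
      -- truncated.
      refine ⟨m + 4 * (if N ∈ C then 1 else 0) - 1, ?_, ?_⟩
      · intro b hb
        rcases Nat.lt_or_ge N b with hb' | hb'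
        · have : b = N + 1 := by omega
          subst this; simp
        · have := hIco b hb'
          have := h1 b hb'
          omega
      · omega
    · rw [if_neg hPN]
      refine ⟨m + 4 * (if N ∈ C then 1 else 0), ?_, by omega⟩
      intro b hb
      rcases Nat.lt_or_ge N b with hb' | hb'
      · have : b = N + 1 := by omega
        subst this; simp
      · have := hIco b hb'
        have := h1 b hb'
        omega

end TreeCode

end NoisyNetwork

/-! ### Stacks of simulated rounds and the potential. -/

namespace NoisyNetwork

/-- A move on a stack: keep it, remove the top element, or add an element. -/
abbrev Move (α : Type*) := Option (Option α)

/-- A stack: its height and its entries from the bottom up. -/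
abbrev Stack (α : Type*) := ℕ × (ℕ → α)

/-- The effect of a move on a stack. -/
def Move.apply {α : Type*} : Move α → Stack α → Stack α
  | none, S => S
  | some none, S => (S.1 - 1, S.2)
  | some (some a), S => (S.1 + 1, Function.update S.2 S.1 a)

/-- The entrywise image of a stack. -/
def Stack.map {α β : Type*} (f : α → β) (S : Stack α) : Stack β := (S.1, fun i => f (S.2 i))

/-- The image of a move. -/
def Move.map {α β : Type*} (f : α → β) (m : Move α) : Move β := Option.map (Option.map f) m

theorem Move.apply_map {α β : Type*} (f : α → β) (m : Move α) (S : Stack α) :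
    (m.map f).apply (S.map f) = (m.apply S).map f := by
  match m with
  | none => rfl
  | some none => rfl
  | some (some a) =>
    refine Prod.ext rfl (funext fun i => ?_)
    simp only [Move.map, Option.map_some, Move.apply, Stack.map, Function.update_apply]
    split_ifs <;> rfl

/-- The stack produced by the moves `0, …, j - 1`. -/
def stackOf {α : Type*} (a : α) (m : ℕ → Move α) : ℕ → Stack α
  | 0 => (0, fun _ => a)
  | j + 1 => (m j).apply (stackOf a m j)

theorem stackOf_congr {α : Type*} {a : α} {m m' : ℕ → Move α} {j : ℕ}
    (h : ∀ i < j, m i = m' i) : stackOf a m j = stackOf a m' j := by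
  induction j with
  | zero => rfl
  | succ j ih =>
    rw [stackOf, stackOf, ih (fun i hi => h i (by omega)), h j (by omega)]

section Rule

variable {ι α : Type*}

/-- The move of a party with stack `S` that believes its neighbours to have the stacks `R`:
remove the last entry if it is more than one ahead of a neighbour or if some entry is not what it
should be, wait for slower neighbours, and otherwise simulate one more round. -/
noncomputable def nextMove (send : (i : ℕ) → (Fin i → ι → Bool) → α) (S : Stack α)
    (R : ι → Stack Bool) : Move α :=
  open Classical in
  if (∃ w, (R w).1 + 1 < S.1) ∨ (∃ i < S.1, S.2 i ≠ send i (fun s w => (R w).2 s)) then some none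
  else if ∃ w, (R w).1 < S.1 then none
  else some (some (send S.1 (fun s w => (R w).2 s)))

/-- `S` has at least the level `k` with respect to the true sequence `truth`: twice the length of
the correct part minus the height is at least `k`. -/
def HasLevel (truth : ℕ → α) (k : ℤ) (S : Stack α) : Prop :=
  ∃ g ≤ S.1, (∀ i < g, S.2 i = truth i) ∧ k + S.1 ≤ 2 * g

/-- With the longest correct part as witness, the entry just above it is known to be wrong; the
consistency test in `nextMove` acts on that entry. -/
theorem HasLevel.exists_maximal {truth : ℕ → α} {k : ℤ} {S : Stack α} (h : HasLevel truth k S) :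
    ∃ g ≤ S.1, (∀ i < g, S.2 i = truth i) ∧ k + S.1 ≤ 2 * g ∧
      (g < S.1 → S.2 g ≠ truth g) := by
  classical
  obtain ⟨g₀, h1, h2, h3⟩ := h
  let P : ℕ → Prop := fun g => ∀ i < g, S.2 i = truth i
  have hP : P (Nat.findGreatest P S.1) := Nat.findGreatest_spec (P := P) h1 h2
  have hle : g₀ ≤ Nat.findGreatest P S.1 := Nat.le_findGreatest h1 h2
  refine ⟨Nat.findGreatest P S.1, Nat.findGreatest_le _, hP, by omega, fun hlt heq => ?_⟩
  refine Nat.findGreatest_is_greatest (P := P) (Nat.lt_succ_self _) hlt ?_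
  intro i hi
  rcases Nat.lt_succ_iff_lt_or_eq.1 hi with h | h
  · exact hP i h
  · rw [h]; exact heq

theorem HasLevel.apply {truth : ℕ → α} {k : ℤ} {S : Stack α} (h : HasLevel truth k S)
    (m : Move α) : HasLevel truth (k - 1) (m.apply S) := by
  obtain ⟨g, h1, h2, h3⟩ := h
  match m with
  | none => exact ⟨g, h1, h2, by simp only [Move.apply]; omega⟩
  | some none =>
    refine ⟨min g (S.1 - 1), by simp [Move.apply], fun i hi => h2 i (by omega), ?_⟩
    simp only [Move.apply]; omega
  | some (some a) =>
    refine ⟨g, by simp only [Move.apply]; omega, fun i hi => ?_, by simp only [Move.apply]; omega⟩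
    simp only [Move.apply]
    rw [Function.update_of_ne (by omega)]
    exact h2 i hi

/-- If all parties know the stacks of their neighbours, the least level rises. -/
theorem HasLevel.nextMove {send : (i : ℕ) → (Fin i → ι → Bool) → α} {truth : ℕ → α}
    {nbr : ι → ℕ → Bool} (htruth : ∀ i, truth i = send i (fun s w => nbr w s))
    {k : ℤ} {S : Stack α} {R : ι → Stack Bool} (hS : HasLevel truth k S)
    (hR : ∀ w, HasLevel (nbr w) k (R w)) :
    HasLevel truth (k + 1) ((nextMove send S R).apply S) := by
  classical
  obtain ⟨g, hg, hcor, hk, hmax⟩ := hS.exists_maximal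
  -- A wrong prediction for round `i` must come from a neighbour whose stack is wrong below `i`; its
  -- level then bounds `k` well below what its height would allow.
  have key : ∀ i, send i (fun s w => (R w).2 s) ≠ truth i →
      ∃ w, ∃ g' < i, k + (R w).1 ≤ 2 * g' ∧ g' ≤ (R w).1 := by
    intro i hi
    by_contra! hcon
    apply hi
    rw [htruth]
    congr 1
    funext s w
    obtain ⟨g', h1, h2, h3⟩ := hR w
    refine h2 s ?_
    by_contra hlt
    have := hcon w g' (by omega) h3
    omega
  have hRle : ∀ w, k ≤ (R w).1 := by
    intro w
    obtain ⟨g', h1, h2, h3⟩ := hR w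
    omega
  unfold NoisyNetwork.nextMove
  split_ifs with hpop hhold
  · rcases Nat.lt_or_ge g S.1 with hlt | hge
    · exact ⟨g, by simp only [Move.apply]; omega, hcor, by simp only [Move.apply]; omega⟩
    · have hk' : k ≤ S.1 - 2 ∧ 1 ≤ S.1 := by
        rcases hpop with ⟨w, hw⟩ | ⟨i, hi, hne⟩
        · have := hRle w
          omega
        · rw [hcor i (by omega)] at hne
          obtain ⟨w, g', h1, h2, h3⟩ := key i (Ne.symm hne)
          omega
      refine ⟨S.1 - 1, le_rfl, fun i hi => hcor i (by omega), ?_⟩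
      simp only [Move.apply]; omega
  · push Not at hpop
    refine ⟨g, hg, hcor, ?_⟩
    simp only [Move.apply]
    by_contra hcon
    obtain ⟨w, hw⟩ := hhold
    have h1 := hRle w
    have h2 := hmax (by omega)
    rw [hpop.2 g (by omega)] at h2
    obtain ⟨w', g', h3, h4, h5⟩ := key g h2
    have := hpop.1 w'
    omega
  · push Not at hpop hhold
    have hold : ∀ g' ≤ S.1, (∀ i < g', S.2 i = truth i) → ∀ i < g',
        (Move.apply (some (some (send S.1 (fun s w => (R w).2 s)))) S).2 i = truth i := by
      intro g' hg' h i hi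
      simp only [Move.apply]
      rw [Function.update_of_ne (by omega)]
      exact h i hi
    rcases Nat.lt_or_ge g S.1 with hlt | hge
    · have h2 := hmax hlt
      rw [hpop.2 g hlt] at h2
      obtain ⟨w, g', h3, h4, h5⟩ := key g h2
      have := hhold w
      refine ⟨g, by simp only [Move.apply]; omega, hold g hg hcor, ?_⟩
      simp only [Move.apply]; omega
    · have hgS : g = S.1 := le_antisymm hg hge
      subst hgS
      by_cases hs : send S.1 (fun s w => (R w).2 s) = truth S.1
      · refine ⟨S.1 + 1, le_rfl, fun i hi => ?_, by simp only [Move.apply]; omega⟩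
        rcases Nat.lt_succ_iff_lt_or_eq.1 hi with h | h
        · exact hold _ le_rfl hcor i h
        · subst h; simpa [Move.apply] using hs
      · obtain ⟨w, g', h3, h4, h5⟩ := key _ hs
        have := hhold w
        refine ⟨S.1, by simp only [Move.apply]; omega, hold _ le_rfl hcor, ?_⟩
        simp only [Move.apply]; omega

end Rule
end NoisyNetwork

/-! ### The tree code simulation, correct when few rounds are corrupted. -/

namespace NoisyNetwork

/-- A history of finitely many rounds, continued by `false`. -/
def extendHistory {W : Type*} {t : ℕ} (h : Fin t → W → Bool) (s : ℕ) (w : W) : Bool :=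
  if hs : s < t then h ⟨s, hs⟩ w else false

theorem extendHistory_of_lt {W : Type*} {t : ℕ} (h : ℕ → W → Bool) {s : ℕ} (hs : s < t) (w : W) :
    extendHistory (fun s : Fin t => h s) s w = h s w := dif_pos hs

/-- The data of a tree code on the moves of stacks of bits over a field whose elements are
transmitted as blocks of bits. -/
structure Scheme (F : Type*) where
  /-- moves as elements of the field -/
  symbol : Move Bool → F
  /-- the coefficients of the tree code -/
  coeff : ℕ → F
  /-- the elements of the field as blocks of bits -/
  code : F → Fin 17 → Bool

namespace Scheme

variable {F : Type*} [Field F] (c : Scheme F) {W : Type*}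

/-- The field element received from `w` in step `j`. -/
noncomputable def heard (H : ℕ → W → Bool) (w : W) (j : ℕ) : F :=
  Function.invFun c.code (fun b => H (j * 17 + b) w)

/-- The moves of `w` before step `j`, as decoded by a receiver with history `H`. -/
noncomputable def decodedMoves (H : ℕ → W → Bool) (w : W) (j : ℕ) : ℕ → Move Bool :=
  decode c.symbol c.coeff (fun i => if i < j then c.heard H w i else 0) j

/-- The stack of `w` at step `j`, as decoded by a receiver with history `H`. -/
noncomputable def decodedStack (H : ℕ → W → Bool) (w : W) (j : ℕ) : Stack Bool :=
  stackOf false (c.decodedMoves H w j) j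

/-- The stack of simulated rounds of a party with history `H`. -/
noncomputable def ownStack (send : (i : ℕ) → (Fin i → W → Bool) → W → Bool)
    (H : ℕ → W → Bool) : ℕ → Stack (W → Bool)
  | 0 => (0, fun _ _ => false)
  | j + 1 => (nextMove send (ownStack send H j) (fun w => c.decodedStack H w j)).apply
      (ownStack send H j)

/-- The move of a party with history `H` in step `j`. -/
noncomputable def ownMove (send : (i : ℕ) → (Fin i → W → Bool) → W → Bool)
    (H : ℕ → W → Bool) (j : ℕ) : Move (W → Bool) :=
  nextMove send (c.ownStack send H j) (fun w => c.decodedStack H w j)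

/-- The field element sent to `u` in step `j`. -/
noncomputable def word (send : (i : ℕ) → (Fin i → W → Bool) → W → Bool)
    (H : ℕ → W → Bool) (u : W) (j : ℕ) : F :=
  conv c.coeff (fun i => c.symbol ((c.ownMove send H i).map (fun f => f u))) j

variable {c} {send : (i : ℕ) → (Fin i → W → Bool) → W → Bool} {H H' : ℕ → W → Bool}

/-- Causality: decoding at step `j` ignores later rounds, so a history continued by `false` serves
as well as the full one. -/
theorem decodedStack_congr {j : ℕ} (h : ∀ s < j * 17, ∀ w, H s w = H' s w) (w : W) :
    c.decodedStack H w j = c.decodedStack H' w j := by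
  unfold decodedStack decodedMoves
  congr 2
  funext i
  split_ifs with hi
  · unfold heard
    congr 1
    funext b
    exact h _ (by omega) w
  · rfl

theorem ownStack_congr {j : ℕ} (h : ∀ s < j * 17, ∀ w, H s w = H' s w) :
    c.ownStack send H j = c.ownStack send H' j := by
  induction j with
  | zero => rfl
  | succ j ih =>
    have h' : ∀ s < j * 17, ∀ w, H s w = H' s w := fun s hs w => h s (by omega) w
    simp only [ownStack, ih h', decodedStack_congr h']

theorem word_congr {j : ℕ} (h : ∀ s < j * 17, ∀ w, H s w = H' s w) (u : W) :
    c.word send H u j = c.word send H' u j := by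
  refine conv_congr (fun _ _ => rfl) fun i hi => ?_
  have h' : ∀ s < i * 17, ∀ w, H s w = H' s w := fun s hs w => h s (by omega) w
  simp only [ownMove, ownStack_congr h', decodedStack_congr h']

/-- A neighbour `u` is told only the bits meant for it. These projected moves suffice to rebuild the
projected stack, which is all that `u` needs. -/
theorem ownStack_map (u : W) (j : ℕ) :
    (c.ownStack send H j).map (fun f => f u)
      = stackOf false (fun i => (c.ownMove send H i).map (fun f => f u)) j := by
  induction j with
  | zero => rfl
  | succ j ih => rw [stackOf, ← ih, Move.apply_map]; rfl

end Scheme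

theorem HasLevel.map {α β : Type*} {truth : ℕ → α} {k : ℤ} {S : Stack α} (h : HasLevel truth k S)
    (f : α → β) : HasLevel (fun i => f (truth i)) k (S.map f) := by
  obtain ⟨g, h1, h2, h3⟩ := h
  exact ⟨g, h1, fun i hi => congrArg f (h2 i hi), h3⟩

variable {V : Type*} {G : SimpleGraph V} {X Y : V → Type*} {T : ℕ}

/-- The bits sent in the noiseless execution of a protocol. -/
def Protocol.truth (π : Protocol G X Y T) (x : ∀ v, X v) (v : V) (i : ℕ) (u : G.neighborSet v) :
    Bool :=
  π.sent (noiseless G X) x i ⟨(v, u), u.2⟩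

theorem Protocol.received_noiseless (π : Protocol G X Y T) (x : ∀ v, X v) (t : ℕ) :
    π.received (noiseless G X) x t = π.sent (noiseless G X) x t := by
  funext d
  rw [π.received_eq]
  simp [noiseless]

theorem Protocol.truth_eq (π : Protocol G X Y T) (x : ∀ v, X v) (v : V) (i : ℕ) :
    π.truth x v i = π.send v (x v) i (fun s w => π.truth x w s ⟨v, G.adj_symm w.2⟩) := by
  funext u
  rw [Protocol.truth, π.sent_eq]
  simp only [π.received_noiseless]
  rfl

theorem Protocol.result_noiseless (π : Protocol G X Y T) (x : ∀ v, X v) (v : V) :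
    π.result (noiseless G X) x v
      = π.output v (x v) (fun s w => π.truth x w s ⟨v, G.adj_symm w.2⟩) := by
  rw [Protocol.result]
  simp only [π.received_noiseless]
  rfl

variable {F : Type*} [Field F]

/-- The simulation of a protocol by `N` steps of `17` rounds in which each party tells each
neighbour, in the tree code, its latest move. -/
noncomputable def Protocol.coded (π : Protocol G X Y T) (c : Scheme F) (N : ℕ) :
    Protocol G X Y (N * 17) where
  send v a t h u :=
    c.code (c.word (π.send v a) (extendHistory h) u (t / 17)) ⟨t % 17, Nat.mod_lt _ (by norm_num)⟩
  output v a h := π.output v a (fun s w => decide (N < 2 * ((Finset.range N).filter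
    (fun j => (c.decodedStack (extendHistory h) w j).2 s = true)).card))

theorem Protocol.coded_sendAll (π : Protocol G X Y T) (c : Scheme F) (N : ℕ) (x : ∀ v, X v)
    (rec : ℕ → G.Dart → Bool) (j : ℕ) (b : Fin 17) (d : G.Dart) :
    (π.coded c N).sendAll x (j * 17 + b) (fun s => rec s) d
      = c.code (c.word (π.send d.fst (x d.fst)) (fun s => inbox d.fst (rec s))
          ⟨d.snd, d.adj⟩ j) b := by
  simp only [Protocol.sendAll, Protocol.coded]
  have h1 : (j * 17 + b.1) / 17 = j := by omega
  have h2 : (⟨(j * 17 + b.1) % 17, Nat.mod_lt _ (by norm_num)⟩ : Fin 17) = b := by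
    apply Fin.ext; simp only; omega
  rw [h1, h2]
  congr 1
  refine Scheme.word_congr (fun s hs w => ?_) _
  exact extendHistory_of_lt (fun s => inbox d.fst (rec s)) (by omega) w

open Classical in
/-- The tree code simulation is correct if few of its rounds are corrupted. -/
theorem Protocol.coded_output (π : Protocol G X Y T) {c : Scheme F}
    (hsym : Function.Injective c.symbol) (hcode : Function.Injective c.code)
    (hc : ∀ σ τ : ℕ → Move Bool, c.symbol (σ 0) ≠ c.symbol (τ 0) → ∀ ℓ, 1 ≤ ℓ → ℓ ≤ 4 * T →
      ∀ S ⊆ Finset.range ℓ,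
        (∀ k ∈ S, conv c.coeff (fun i => c.symbol (σ i) - c.symbol (τ i)) k = 0) →
          2 * S.card < ℓ)
    (x : ∀ v, X v) (rec : ℕ → G.Dart → Bool)
    (hrec : 16 * ((Finset.range (4 * T * 17)).filter (fun r =>
      rec r ≠ (π.coded c (4 * T)).sendAll x r (fun s => rec s))).card ≤ T) (v : V) :
    (π.coded c (4 * T)).output v (x v) (fun s => inbox v (rec s))
      = π.result (noiseless G X) x v := by
  set N := 4 * T with hN
  let H : ∀ v, ℕ → G.neighborSet v → Bool := fun v s => inbox v (rec s)
  let st : ∀ v, ℕ → Stack (G.neighborSet v → Bool) := fun v j =>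
    c.ownStack (π.send v (x v)) (H v) j
  let Good : ℕ → Prop := fun j => ∀ v (w : G.neighborSet v),
    c.decodedStack (H v) w j = (st w j).map (fun f => f ⟨v, G.adj_symm w.2⟩)
  let C : Finset ℕ := ((Finset.range (N * 17)).filter (fun r =>
      rec r ≠ (π.coded c N).sendAll x r (fun s => rec s))).image (fun r => r / 17)
  have hC : 16 * C.card ≤ T :=
    le_trans (Nat.mul_le_mul_left _ Finset.card_image_le) hrec
  have hheard : ∀ v (w : G.neighborSet v) (i : ℕ), i < N → i ∉ C →
      c.heard (H v) w i = c.word (π.send w (x w)) (H w) ⟨v, G.adj_symm w.2⟩ i := by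
    intro v w i hi hiC
    have : ∀ b : Fin 17, H v (i * 17 + b) w
        = c.code (c.word (π.send w (x w)) (H w) ⟨v, G.adj_symm w.2⟩ i) b := by
      intro b
      by_contra hne
      apply hiC
      refine Finset.mem_image.2 ⟨i * 17 + b, Finset.mem_filter.2
        ⟨Finset.mem_range.2 (by omega), fun heq => hne ?_⟩, by omega⟩
      have := congrFun heq ⟨(w.1, v), G.adj_symm w.2⟩
      rw [Protocol.coded_sendAll] at this
      exact this
    rw [Scheme.heard, funext this]
    exact Function.leftInverse_invFun hcode _
  -- The predicate holds only for `j ≤ N`, the range of the tree code, so `card_dense_windows` can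
  -- be applied with a condition on all `j`.
  have hbad : ∀ j, ¬ (j ≤ N → Good j) → ∃ a < j, j - a < 4 * (C ∩ Finset.Ico a j).card := by
    intro j hj
    push Not at hj
    obtain ⟨hjN, hj⟩ := hj
    simp only [Good] at hj
    push Not at hj
    obtain ⟨v, w, hne⟩ := hj
    refine decode_error hsym hc
      (fun i => (c.ownMove (π.send w (x w)) (H w) i).map (fun f => f ⟨v, G.adj_symm w.2⟩))
      (fun i => if i < j then c.heard (H v) w i else 0) C hjN (fun i hi hiC => ?_) ?_
    · simp only [hi, if_true]
      exact hheard v w i (by omega) hiC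
    · by_contra! hcon
      apply hne
      simp only [st]
      rw [Scheme.ownStack_map, Scheme.decodedStack]
      exact stackOf_congr hcon
  let bad : ℕ → ℕ := fun M => ((Finset.range M).filter (fun j => ¬ (j ≤ N → Good j))).card
  have hbadN : bad N ≤ 4 * C.card := card_dense_windows C N _ hbad
  -- A bad step costs two: the level may drop by one instead of rising by one.
  have hlevel : ∀ j ≤ N, ∀ v, HasLevel (π.truth x v) ((j : ℤ) - 2 * bad j) (st v j) := by
    intro j
    induction j with
    | zero => intro _ v; exact ⟨0, le_rfl, by simp, by simp [bad, st, Scheme.ownStack]⟩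
    | succ j ih =>
      intro hj v
      have ih' := ih (by omega)
      have hstep : st v (j + 1) = (nextMove (π.send v (x v)) (st v j)
        (fun w => c.decodedStack (H v) w j)).apply (st v j) := rfl
      by_cases hg : j ≤ N → Good j
      · have hb : bad (j + 1) = bad j := by
          simp only [bad, Finset.range_add_one, Finset.filter_insert]
          rw [if_neg (not_not.2 hg)]
        have := HasLevel.nextMove (send := π.send v (x v)) (truth := π.truth x v)
          (nbr := fun w s => π.truth x w s ⟨v, G.adj_symm w.2⟩) (π.truth_eq x v) (ih' v)
          (R := fun w => c.decodedStack (H v) w j) (fun w => by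
            rw [hg (by omega) v w]
            exact (ih' w).map (fun f => f ⟨v, G.adj_symm w.2⟩))
        rw [hstep, hb]
        convert this using 1
        push_cast; ring
      · have hb : bad (j + 1) = bad j + 1 := by
          simp only [bad, Finset.range_add_one, Finset.filter_insert]
          rw [if_pos hg, Finset.card_insert_of_notMem (by simp)]
        have := (ih' v).apply (nextMove (π.send v (x v)) (st v j)
          (fun w => c.decodedStack (H v) w j))
        rw [hstep, hb]
        convert this using 1
        push_cast; ring
  have hmono : ∀ j ≤ N, bad j ≤ bad N := fun j hj =>
    Finset.card_le_card (Finset.filter_subset_filter _ (Finset.range_mono hj))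
  rw [π.result_noiseless]
  simp only [Protocol.coded]
  congr 1
  funext s w
  -- The steps at which the decoded stack surely has a correct part of length at least `T`. As `bad
  -- N ≤ T / 4`, there are at least `3 T - 3 T / 4 > N / 2` of them, so a majority over all steps is
  -- right although no party knows which steps are good.
  let J := (Finset.range N).filter (fun j => Good j ∧ T + 2 * bad N ≤ j)
  have hJ : N ≤ J.card + bad N + (T + 2 * bad N) := by
    have hcov : Finset.range N ⊆ (J ∪ (Finset.range N).filter (fun j => ¬ (j ≤ N → Good j)))
        ∪ Finset.range (T + 2 * bad N) := by
      intro j hj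
      have hj' := Finset.mem_range.1 hj
      simp only [J, Finset.mem_union, Finset.mem_filter, hj, true_and, Finset.mem_range]
      by_cases hg : Good j
      · by_cases hl : T + 2 * bad N ≤ j
        · exact Or.inl (Or.inl ⟨hg, hl⟩)
        · exact Or.inr (by omega)
      · exact Or.inl (Or.inr (fun h => hg (h hj'.le)))
    have h1 := Finset.card_le_card hcov
    have h2 := Finset.card_union_le (J ∪ (Finset.range N).filter (fun j => ¬ (j ≤ N → Good j)))
      (Finset.range (T + 2 * bad N))
    have h3 := Finset.card_union_le J ((Finset.range N).filter (fun j => ¬ (j ≤ N → Good j)))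
    simp only [Finset.card_range] at h1 h2
    simp only [bad] at h1 h2 h3 ⊢
    omega
  have hval : ∀ j ∈ J, (c.decodedStack (extendHistory (fun s : Fin (N * 17) => inbox v (rec s)))
      w j).2 s = π.truth x w s ⟨v, G.adj_symm w.2⟩ := by
    intro j hj
    obtain ⟨hjN, hg, hl⟩ := Finset.mem_filter.1 hj
    have hjN := Finset.mem_range.1 hjN
    rw [Scheme.decodedStack_congr (H' := H v) (fun t ht w =>
      extendHistory_of_lt (fun s => inbox v (rec s)) (by omega) w), hg v w]
    -- A level of at least `T` forces `g ≥ T > s`, since `g` is at most the height.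
    obtain ⟨g, h1, h2, h3⟩ := hlevel j hjN.le w
    have := hmono j hjN.le
    have hs := s.2
    simp only [Stack.map]
    rw [h2 s (by omega)]
  have hs := s.2
  have hJ2 : N < 2 * J.card := by omega
  by_cases htr : π.truth x w s ⟨v, G.adj_symm w.2⟩ = true
  · rw [htr, decide_eq_true_eq]
    refine hJ2.trans_le (Nat.mul_le_mul_left _ (Finset.card_le_card fun j hj => ?_))
    exact Finset.mem_filter.2 ⟨(Finset.mem_filter.1 hj).1, (hval j hj).trans htr⟩
  · rw [Bool.not_eq_true] at htr
    rw [htr, decide_eq_false_iff_not, not_lt]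
    have hsub : ((Finset.range N).filter (fun j => (c.decodedStack (extendHistory
        (fun s : Fin (N * 17) => inbox v (rec s))) w j).2 s = true)) ⊆ Finset.range N \ J := by
      intro j hj
      obtain ⟨h1, h2⟩ := Finset.mem_filter.1 hj
      refine Finset.mem_sdiff.2 ⟨h1, fun hjJ => ?_⟩
      rw [hval j hjJ, htr] at h2
      exact Bool.false_ne_true h2
    have h1 := Finset.card_le_card hsub
    rw [Finset.card_sdiff_of_subset (Finset.filter_subset _ _), Finset.card_range] at h1
    change _ ≤ N - J.card at h1
    have : J.card ≤ N := by simpa using Finset.card_filter_le (Finset.range N) _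
    refine le_trans (Nat.mul_le_mul_left 2 h1) ?_
    omega

end NoisyNetwork

/-! ### Routing through random intermediate vertices. -/

namespace NoisyNetwork

variable {V : Type*} {G : SimpleGraph V} {X Y : V → Type*} {T : ℕ}

section Routing

variable {M : Type*} [AddCommGroup M] (φ : V ≃ M)

/-- The intermediate vertex between `u` and `v` for the shift `s`. -/
def via (s : M) (u v : V) : V := φ.symm (s - φ u - φ v)

theorem via_comm (s : M) (u v : V) : via φ s u v = via φ s v u := by
  unfold via; congr 1; abel

theorem via_via (s : M) (u v : V) : via φ s u (via φ s u v) = v := by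
  unfold via; simp

/-- The vertices `u` and `v` can communicate through `m`. -/
def Linked (G : SimpleGraph V) (u v m : V) : Prop := G.Adj u m ∧ G.Adj m v

open Classical in
/-- The bit of `w` that `v` accepts in block `r` of length `2 * L`: the majority of the bits that
came through an intermediate vertex. -/
noncomputable def accepted (G : SimpleGraph V) (L : ℕ) (s : ℕ → ℕ → M) (v : V)
    (H : ℕ → V → Bool) (r : ℕ) (w : V) : Bool :=
  decide ((Finset.univ.filter (fun i : Fin L => Linked G w v (via φ (s r i) w v) ∧
      H (r * (2 * L) + 2 * i + 1) (via φ (s r i) w v) = false)).card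
    < (Finset.univ.filter (fun i : Fin L => Linked G w v (via φ (s r i) w v) ∧
      H (r * (2 * L) + 2 * i + 1) (via φ (s r i) w v) = true)).card)

open Classical in
/-- A history of finitely many rounds as a function on all rounds and all vertices. -/
noncomputable def fullHistory {t : ℕ} {v : V} (h : Fin t → G.neighborSet v → Bool) (s : ℕ) (w : V) :
    Bool :=
  if hs : s < t ∧ G.Adj v w then h ⟨s, hs.1⟩ ⟨w, hs.2⟩ else false

open Classical in
/-- The protocol in which each bit of `π` is sent `L` times, through two hops each time; the
intermediate vertices are given by the shifts `s`. -/
noncomputable def Protocol.routed (π : Protocol G X Y T) (L : ℕ) (s : ℕ → ℕ → M) :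
    Protocol G X Y (T * (2 * L)) where
  send v a t h u :=
    let z := via φ (s (t / (2 * L)) (t % (2 * L) / 2)) v u
    if t % 2 = 0 then
      if hz : G.Adj v z then
        π.send v a (t / (2 * L)) (fun r w => accepted φ G L s v (fullHistory h) r w) ⟨z, hz⟩
      else false
    else fullHistory h (t - 1) z
  output v a h := π.output v a (fun r w => accepted φ G L s v (fullHistory h) r w)

/-- A family of bits on the darts, extended by `false` to all pairs of vertices. -/
noncomputable def onPairs (e : G.Dart → Bool) (u v : V) : Bool :=
  open Classical in if h : G.Adj u v then e ⟨(u, v), h⟩ else false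

/-- Whether the bit from `u` to `v` through `m` is flipped in the hops of the rounds `t`, `t + 1`. -/
noncomputable def flipped (e : ℕ → G.Dart → Bool) (t : ℕ) (u v m : V) : Bool :=
  xor (onPairs (e t) u m) (onPairs (e (t + 1)) m v)

/-- In block `r`, with the shifts `σ`, the flips `e` may change the accepted bit of some dart. -/
def Flawed (L : ℕ) (e : ℕ → G.Dart → Bool) (r : ℕ) (σ : Fin L → M) : Prop :=
  open Classical in ∃ u v, G.Adj u v ∧
    (Finset.univ.filter (fun i : Fin L => Linked G u v (via φ (σ i) u v) ∧
      flipped e (r * (2 * L) + 2 * i) u v (via φ (σ i) u v) = false)).card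
    ≤ (Finset.univ.filter (fun i : Fin L => Linked G u v (via φ (σ i) u v) ∧
      flipped e (r * (2 * L) + 2 * i) u v (via φ (σ i) u v) = true)).card

variable {φ} {L : ℕ} {s : ℕ → ℕ → M}

open Classical in
theorem accepted_congr {v : V} {H H' : ℕ → V → Bool} {r : ℕ}
    (h : ∀ t < (r + 1) * (2 * L), ∀ w, H t w = H' t w) (w : V) :
    accepted φ G L s v H r w = accepted φ G L s v H' r w := by
  have : ∀ (i : Fin L) (m : V),
      H (r * (2 * L) + 2 * i + 1) m = H' (r * (2 * L) + 2 * i + 1) m := fun i m => by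
    refine h _ ?_ m
    have := i.2
    rw [add_one_mul]
    omega
  have hf : ∀ b, (Finset.univ.filter (fun i : Fin L => Linked G w v (via φ (s r i) w v) ∧
      H (r * (2 * L) + 2 * i + 1) (via φ (s r i) w v) = b))
      = (Finset.univ.filter (fun i : Fin L => Linked G w v (via φ (s r i) w v) ∧
      H' (r * (2 * L) + 2 * i + 1) (via φ (s r i) w v) = b)) :=
    fun b => Finset.filter_congr fun i _ => by rw [this]
  rw [accepted, accepted, hf, hf]

/-- The received bits as functions on the pairs of vertices. -/
noncomputable def incoming (rec : ℕ → G.Dart → Bool) (v : V) (t : ℕ) (w : V) : Bool :=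
  onPairs (rec t) w v

theorem fullHistory_inbox (rec : ℕ → G.Dart → Bool) (v : V) {t s : ℕ} (hs : s < t) (w : V) :
    fullHistory (fun s : Fin t => inbox v (rec s)) s w = incoming rec v s w := by
  unfold fullHistory incoming onPairs
  by_cases h : G.Adj v w
  · rw [dif_pos ⟨hs, h⟩, dif_pos h.symm]; rfl
  · rw [dif_neg (fun h' => h h'.2), dif_neg (fun h' => h h'.symm)]

variable (φ L s) in
/-- The bits accepted from the routed protocol. -/
noncomputable def acceptedAll (rec : ℕ → G.Dart → Bool) (r : ℕ) (d : G.Dart) : Bool :=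
  accepted φ G L s d.snd (incoming rec d.snd) r d.fst

theorem Protocol.routed_output (π : Protocol G X Y T) (rec : ℕ → G.Dart → Bool)
    (x : ∀ v, X v) (v : V) :
    (π.routed φ L s).output v (x v) (fun t => inbox v (rec t))
      = π.output v (x v) (fun r => inbox v (acceptedAll φ L s rec r)) := by
  simp only [Protocol.routed]
  congr 1
  funext r w
  refine accepted_congr (fun t ht w => fullHistory_inbox rec v (ht.trans_le ?_) w) _
  exact Nat.mul_le_mul_right _ r.2

/-- First hop. For a fixed shift, `via` is an involution in its second vertex, so `u` recovers the
addressee `v` from the intermediate vertex. -/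
theorem Protocol.routed_sendAll_even (π : Protocol G X Y T) (rec : ℕ → G.Dart → Bool)
    (x : ∀ v, X v) (r : ℕ) (i : Fin L) {u v : V} (huv : G.Adj u v)
    (hm : G.Adj u (via φ (s r i) u v)) :
    (π.routed φ L s).sendAll x (r * (2 * L) + 2 * i) (fun t => rec t)
        ⟨(u, via φ (s r i) u v), hm⟩
      = π.sendAll x r (fun r' => acceptedAll φ L s rec r') ⟨(u, v), huv⟩ := by
  have hi := i.2
  have h1 : (r * (2 * L) + 2 * i.1) / (2 * L) = r := by
    rw [mul_comm, Nat.mul_add_div (by omega), Nat.div_eq_of_lt (by omega), add_zero]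
  have h2 : (r * (2 * L) + 2 * i.1) % (2 * L) / 2 = i := by
    rw [mul_comm, Nat.mul_add_mod, Nat.mod_eq_of_lt (by omega)]; omega
  have h3 : (r * (2 * L) + 2 * i.1) % 2 = 0 := by
    rw [show r * (2 * L) + 2 * i.1 = 2 * (r * L + i) by ring]; omega
  -- The block index and the addressee are generalised because the type of the history depends on
  -- the former and the adjacency proof on the latter.
  have hsend : ∀ q z, q = r → z = v → ∀ hz : G.Adj u z,
      π.send u (x u) q (fun r' w => accepted φ G L s u (fullHistory
        (fun t : Fin (r * (2 * L) + 2 * i) => inbox u (rec t))) r' w) ⟨z, hz⟩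
      = π.sendAll x r (fun r' => acceptedAll φ L s rec r') ⟨(u, v), huv⟩ := by
    rintro _ _ rfl rfl hz
    rw [Protocol.sendAll]
    congr 1
    funext r' w
    refine accepted_congr (fun t ht w => fullHistory_inbox rec u (ht.trans_le ?_) w) _
    have := Nat.mul_le_mul_right (2 * L) r'.2
    rw [Nat.succ_eq_add_one] at this
    omega
  rw [Protocol.sendAll]
  simp only [Protocol.routed]
  have hz : via φ (s ((r * (2 * L) + 2 * i.1) / (2 * L))
      ((r * (2 * L) + 2 * i.1) % (2 * L) / 2)) u (via φ (s r i) u v) = v := by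
    rw [h1, h2, via_via]
  rw [if_pos h3, dif_pos (by rw [hz]; exact huv)]
  exact hsend _ _ h1 hz _

/-- Second hop. By symmetry of `via`, the intermediate vertex recovers the origin `u` in the same
way and forwards what came from there. -/
theorem Protocol.routed_sendAll_odd (π : Protocol G X Y T) (rec : ℕ → G.Dart → Bool)
    (x : ∀ v, X v) (r : ℕ) (i : Fin L) {u v : V} (hm : G.Adj (via φ (s r i) u v) v) :
    (π.routed φ L s).sendAll x (r * (2 * L) + 2 * i + 1) (fun t => rec t)
        ⟨(via φ (s r i) u v, v), hm⟩
      = incoming rec (via φ (s r i) u v) (r * (2 * L) + 2 * i) u := by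
  have hi := i.2
  have h1 : (r * (2 * L) + 2 * i.1 + 1) / (2 * L) = r := by
    rw [mul_comm, add_assoc, Nat.mul_add_div (by omega), Nat.div_eq_of_lt (by omega), add_zero]
  have h2 : (r * (2 * L) + 2 * i.1 + 1) % (2 * L) / 2 = i := by
    rw [mul_comm, add_assoc, Nat.mul_add_mod, Nat.mod_eq_of_lt (by omega)]; omega
  have h3 : (r * (2 * L) + 2 * i.1 + 1) % 2 = 1 := by
    rw [show r * (2 * L) + 2 * i.1 + 1 = 2 * (r * L + i) + 1 by ring]; omega
  have h4 : via φ (s r i) (via φ (s r i) u v) v = u := by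
    rw [via_comm, via_comm φ _ u v, via_via]
  simp only [Protocol.sendAll, Protocol.routed, h1, h2, h3, one_ne_zero, if_false, h4,
    Nat.add_sub_cancel]
  exact fullHistory_inbox rec _ (by omega) _

/-- If the block `r` is not flawed, all the bits of this block are accepted as they were sent. -/
theorem Protocol.acceptedAll_eq (π : Protocol G X Y T) (rec e : ℕ → G.Dart → Bool)
    (x : ∀ v, X v) (r : ℕ)
    (he : ∀ t < (r + 1) * (2 * L), ∀ d,
      rec t d = xor ((π.routed φ L s).sendAll x t (fun t => rec t) d) (e t d))
    (hr : ¬ Flawed φ L e r (fun i => s r i)) :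
    acceptedAll φ L s rec r = π.sendAll x r (fun r' => acceptedAll φ L s rec r') := by
  classical
  funext ⟨⟨u, v⟩, huv⟩
  set b := π.sendAll x r (fun r' => acceptedAll φ L s rec r') ⟨(u, v), huv⟩ with hb
  have key : ∀ i : Fin L, Linked G u v (via φ (s r i) u v) →
      incoming rec v (r * (2 * L) + 2 * i + 1) (via φ (s r i) u v)
        = xor b (flipped e (r * (2 * L) + 2 * i) u v (via φ (s r i) u v)) := by
    rintro i ⟨h1, h2⟩
    have hi := i.2
    have ht : r * (2 * L) + 2 * i.1 + 1 < (r + 1) * (2 * L) := by rw [add_one_mul]; omega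
    unfold incoming flipped onPairs
    rw [dif_pos h2, dif_pos h1, dif_pos h2, he _ ht, π.routed_sendAll_odd]
    unfold incoming onPairs
    rw [dif_pos h1, he _ (by omega), π.routed_sendAll_even rec x r i huv h1, ← hb, Bool.xor_assoc]
  have hnot : (Finset.univ.filter (fun i : Fin L => Linked G u v (via φ (s r i) u v) ∧
      flipped e (r * (2 * L) + 2 * i) u v (via φ (s r i) u v) = true)).card
      < (Finset.univ.filter (fun i : Fin L => Linked G u v (via φ (s r i) u v) ∧
      flipped e (r * (2 * L) + 2 * i) u v (via φ (s r i) u v) = false)).card := by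
    by_contra hcon
    exact hr ⟨u, v, huv, not_lt.1 hcon⟩
  have hfilter : ∀ b', (Finset.univ.filter (fun i : Fin L => Linked G u v (via φ (s r i) u v) ∧
      incoming rec v (r * (2 * L) + 2 * i + 1) (via φ (s r i) u v) = b'))
      = (Finset.univ.filter (fun i : Fin L => Linked G u v (via φ (s r i) u v) ∧
      flipped e (r * (2 * L) + 2 * i) u v (via φ (s r i) u v) = xor b b')) := by
    intro b'
    refine Finset.filter_congr fun i _ => and_congr_right fun hl => ?_
    rw [key i hl]
    have hxor : ∀ b f b' : Bool, (xor b f = b') ↔ f = xor b b' := by decide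
    exact hxor _ _ _
  simp only [acceptedAll, accepted]
  rw [hfilter false, hfilter true]
  clear_value b
  cases b
  · simpa using hnot.le
  · simpa using hnot

end Routing

/-- If few blocks are flawed, the routed protocol behaves like the protocol with few corrupted
rounds. -/
theorem Protocol.card_corrupted_le {M : Type*} [AddCommGroup M] {φ : V ≃ M} {L : ℕ}
    {s : ℕ → ℕ → M} (π : Protocol G X Y T) (rec e : ℕ → G.Dart → Bool) (x : ∀ v, X v)
    (he : ∀ t < T * (2 * L), ∀ d,
      rec t d = xor ((π.routed φ L s).sendAll x t (fun t => rec t) d) (e t d)) :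
    open Classical in ((Finset.range T).filter (fun r => acceptedAll φ L s rec r
        ≠ π.sendAll x r (fun r' => acceptedAll φ L s rec r'))).card
      ≤ ((Finset.range T).filter (fun r => Flawed φ L e r (fun i => s r i))).card := by
  classical
  refine Finset.card_le_card fun r hr => ?_
  obtain ⟨h1, h2⟩ := Finset.mem_filter.1 hr
  refine Finset.mem_filter.2 ⟨h1, ?_⟩
  by_contra hcon
  refine h2 (π.acceptedAll_eq rec e x r (fun t ht d => he t (ht.trans_le ?_) d) hcon)
  exact Nat.mul_le_mul_right _ (Finset.mem_range.1 h1)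

end NoisyNetwork

/-! ### Flawed blocks are rare for a fixed pattern of flips. -/

namespace NoisyNetwork

section

variable {V : Type*} {G : SimpleGraph V}

open Classical in
/-- A factor `2` for each flipped copy and a factor `1 / 2` for each copy that arrives. -/
noncomputable def copyWeight (e : ℕ → G.Dart → Bool) (t : ℕ) (u v m : V) : ℝ :=
  (if Linked G u v m ∧ flipped e t u v m = true then 2 else 1) *
    (if Linked G u v m ∧ flipped e t u v m = false then 2⁻¹ else 1)

theorem copyWeight_nonneg (e : ℕ → G.Dart → Bool) (t : ℕ) (u v m : V) :
    0 ≤ copyWeight e t u v m := by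
  unfold copyWeight
  split_ifs <;> norm_num

end

variable {V : Type*} [Fintype V] {G : SimpleGraph V} [DecidableRel G.Adj]

theorem card_dart_le : Fintype.card G.Dart ≤ Fintype.card V ^ 2 := by
  rw [sq, ← Fintype.card_prod]
  exact Fintype.card_le_of_injective _ SimpleGraph.Dart.toProd_injective

/-- The number of flips. -/
def flipCount (f : G.Dart → Bool) : ℕ := (Finset.univ.filter (fun d => f d = true)).card

/-- The number of flips in the block `r` of length `2 * L`. -/
def blockFlips (L : ℕ) (e : ℕ → G.Dart → Bool) (r : ℕ) : ℕ :=
  ∑ t ∈ Finset.range (2 * L), flipCount (e (r * (2 * L) + t))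

theorem sum_blockFlips (L : ℕ) (e : ℕ → G.Dart → Bool) (R : ℕ) :
    ∑ r ∈ Finset.range R, blockFlips L e r
      = ∑ t ∈ Finset.range (R * (2 * L)), flipCount (e t) := by
  induction R with
  | zero => simp
  | succ R ih => rw [Finset.sum_range_succ, ih, add_one_mul, Finset.sum_range_add]; rfl

theorem sum_range_two_mul {A : Type*} [AddCommMonoid A] (a : ℕ → A) (L : ℕ) :
    ∑ i : Fin L, (a (2 * i) + a (2 * i + 1)) = ∑ t ∈ Finset.range (2 * L), a t := by
  rw [Fin.sum_univ_eq_sum_range (fun i => a (2 * i) + a (2 * i + 1)) L]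
  induction L with
  | zero => simp
  | succ L ih =>
    rw [Finset.sum_range_succ, ih, show 2 * (L + 1) = 2 * L + 1 + 1 by ring,
      Finset.sum_range_succ, Finset.sum_range_succ, add_assoc]

-- Distinct intermediate vertices use distinct darts in each hop, so one flip of the adversary
-- spoils at most one path from `u` to `v`.
open Classical in
theorem card_flipped_le (e : ℕ → G.Dart → Bool) (t : ℕ) (u v : V) :
    (Finset.univ.filter (fun m => flipped e t u v m = true)).card
      ≤ flipCount (e t) + flipCount (e (t + 1)) := by
  have hsub : Finset.univ.filter (fun m => flipped e t u v m = true)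
      ⊆ (Finset.univ.filter (fun d => e t d = true)).image (fun d => d.snd)
        ∪ (Finset.univ.filter (fun d => e (t + 1) d = true)).image (fun d => d.fst) := by
    intro m hm
    have hm := (Finset.mem_filter.1 hm).2
    rw [Finset.mem_union, Finset.mem_image, Finset.mem_image]
    rw [flipped] at hm
    by_cases h1 : ∃ h : G.Adj u m, e t ⟨(u, m), h⟩ = true
    · obtain ⟨h, h1⟩ := h1
      exact Or.inl ⟨_, Finset.mem_filter.2 ⟨Finset.mem_univ _, h1⟩, rfl⟩
    · right
      have h0 : onPairs (e t) u m = false := by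
        unfold onPairs
        split_ifs with h
        · exact Bool.eq_false_iff.2 fun h' => h1 ⟨h, h'⟩
        · rfl
      rw [h0, Bool.false_xor, onPairs] at hm
      by_cases h2 : G.Adj m v
      · refine ⟨⟨(m, v), h2⟩, Finset.mem_filter.2 ⟨Finset.mem_univ _, ?_⟩, rfl⟩
        rwa [dif_pos h2] at hm
      · rw [dif_neg h2] at hm
        exact absurd hm Bool.false_ne_true
  exact (Finset.card_le_card hsub).trans ((Finset.card_union_le _ _).trans
    (add_le_add Finset.card_image_le Finset.card_image_le))

section

variable {M : Type*} [AddCommGroup M] [Fintype M] (φ : V ≃ M)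

/-- The map from shifts to intermediate vertices. -/
def viaEquiv (u v : V) : M ≃ V := ((Equiv.subRight (φ u)).trans (Equiv.subRight (φ v))).trans φ.symm

/-- A uniform shift gives a uniform intermediate vertex. Relative to weight one, a usable path saves
`1 / 2`, and a flip costs at most `3 / 2` more. -/
theorem sum_copyWeight_le {ε : ℝ} {u v : V}
    (h : ε * (Fintype.card V : ℝ) ≤ (Fintype.card (G.commonNeighbors u v) : ℝ))
    (e : ℕ → G.Dart → Bool) (t : ℕ) :
    ∑ s : M, copyWeight e t u v (via φ s u v) ≤ (Fintype.card V : ℝ) * Real.exp (-(ε / 2) +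
      3 / (2 * Fintype.card V) * (flipCount (e t) + flipCount (e (t + 1)) : ℕ)) := by
  classical
  have hpos : (0 : ℝ) < Fintype.card V := by exact_mod_cast Fintype.card_pos_iff.2 ⟨u⟩
  have h1 : ∑ s : M, copyWeight e t u v (via φ s u v) = ∑ m, copyWeight e t u v m :=
    (viaEquiv φ u v).sum_comp (fun m => copyWeight e t u v m)
  have h2 : ∀ m, copyWeight e t u v m ≤ 1 - (if Linked G u v m then 1 else 0) * (1 / 2) +
      (if flipped e t u v m = true then 1 else 0) * (3 / 2) := by
    intro m
    unfold copyWeight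
    by_cases hl : Linked G u v m <;> by_cases hf : flipped e t u v m = true <;>
      simp [hl, hf] <;> norm_num
  have h3 : (Finset.univ.filter (fun m => Linked G u v m)).card
      = Fintype.card (G.commonNeighbors u v) := by
    rw [← Set.toFinset_card]
    congr 1
    ext m
    rw [Finset.mem_filter_univ, Set.mem_toFinset, SimpleGraph.mem_commonNeighbors, Linked,
      G.adj_comm m v]
  have h4 : ∑ m, copyWeight e t u v m ≤ (Fintype.card V : ℝ)
      - (Fintype.card (G.commonNeighbors u v) : ℝ) * (1 / 2)
      + ((Finset.univ.filter (fun m => flipped e t u v m = true)).card : ℝ) * (3 / 2) := by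
    refine (Finset.sum_le_sum fun m _ => h2 m).trans (le_of_eq ?_)
    rw [Finset.sum_add_distrib, Finset.sum_sub_distrib, ← Finset.sum_mul, ← Finset.sum_mul,
      Finset.sum_boole, Finset.sum_boole, h3]
    simp
  have h5 : ((Finset.univ.filter (fun m => flipped e t u v m = true)).card : ℝ)
      ≤ (flipCount (e t) + flipCount (e (t + 1)) : ℕ) := by
    exact_mod_cast card_flipped_le e t u v
  rw [h1]
  set k : ℝ := ((flipCount (e t) + flipCount (e (t + 1)) : ℕ) : ℝ)
  calc ∑ m, copyWeight e t u v m
      ≤ Fintype.card V * (-(ε / 2) + 3 / (2 * Fintype.card V) * k + 1) := by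
        have : (Fintype.card V : ℝ) * (3 / (2 * Fintype.card V) * k) = k * (3 / 2) := by
          field_simp
        rw [mul_add, mul_add, this]
        linarith
    _ ≤ _ := by gcongr; exact Real.add_one_le_exp _

open Classical in
/-- A block with few flips is rarely flawed. -/
theorem card_flawed_le {ε : ℝ} (hG : ∀ u v : V, G.Adj u v →
      ε * (Fintype.card V : ℝ) ≤ (Fintype.card (G.commonNeighbors u v) : ℝ))
    {L : ℕ} (e : ℕ → G.Dart → Bool) (r : ℕ)
    (hr : (blockFlips L e r : ℝ) ≤ ε * Fintype.card V * L / 6) :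
    ((Finset.univ.filter (fun σ : Fin L → M => Flawed φ L e r σ)).card : ℝ)
      ≤ Fintype.card V ^ 2 * Real.exp (-(ε * L / 4)) * Fintype.card V ^ L := by
  let bad : V × V → Finset (Fin L → M) := fun p => Finset.univ.filter (fun σ =>
    (Finset.univ.filter (fun i : Fin L => Linked G p.1 p.2 (via φ (σ i) p.1 p.2) ∧
      flipped e (r * (2 * L) + 2 * i) p.1 p.2 (via φ (σ i) p.1 p.2) = false)).card
    ≤ (Finset.univ.filter (fun i : Fin L => Linked G p.1 p.2 (via φ (σ i) p.1 p.2) ∧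
      flipped e (r * (2 * L) + 2 * i) p.1 p.2 (via φ (σ i) p.1 p.2) = true)).card)
  let E : Finset (V × V) := Finset.univ.filter (fun p => G.Adj p.1 p.2)
  have hsub : Finset.univ.filter (fun σ : Fin L → M => Flawed φ L e r σ) ⊆ E.biUnion bad := by
    intro σ hσ
    obtain ⟨u, v, huv, hle⟩ := (Finset.mem_filter.1 hσ).2
    exact Finset.mem_biUnion.2 ⟨(u, v), Finset.mem_filter.2 ⟨Finset.mem_univ _, huv⟩,
      Finset.mem_filter.2 ⟨Finset.mem_univ _, hle⟩⟩
  have hbad : ∀ p ∈ E, ((bad p).card : ℝ) ≤ Real.exp (-(ε * L / 4)) * Fintype.card V ^ L := by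
    rintro ⟨u, v⟩ hp
    have huv : G.Adj u v := (Finset.mem_filter.1 hp).2
    have hpos : (0 : ℝ) < Fintype.card V := by exact_mod_cast Fintype.card_pos_iff.2 ⟨u⟩
    -- The product of the weights is two to the number of flipped copies minus that of intact ones,
    -- hence at least one when the majority may fail.
    have h1 := mul_card_le_prod_sum (bad (u, v))
      (fun i s => copyWeight e (r * (2 * L) + 2 * i) u v (via φ s u v))
      (fun i s => copyWeight_nonneg _ _ _ _ _) 1 (fun σ hσ => by
        have hle := (Finset.mem_filter.1 hσ).2
        simp only [copyWeight, Finset.prod_mul_distrib, Finset.prod_ite, Finset.prod_const,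
          one_pow, mul_one]
        rw [inv_pow, ← div_eq_mul_inv, one_le_div (by positivity)]
        exact pow_le_pow_right₀ (by norm_num) hle)
    rw [one_mul] at h1
    let a : ℕ → ℕ := fun t => flipCount (e (r * (2 * L) + t))
    have h2 := Finset.prod_le_prod (s := Finset.univ)
      (fun (i : Fin L) _ => Finset.sum_nonneg fun (s : M) _ =>
        copyWeight_nonneg e (r * (2 * L) + 2 * i) u v (via φ s u v))
      (fun (i : Fin L) _ => sum_copyWeight_le φ (hG u v huv) e (r * (2 * L) + 2 * i))
    have h3 : ∏ i : Fin L, ((Fintype.card V : ℝ) * Real.exp (-(ε / 2) +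
        3 / (2 * Fintype.card V) * (a (2 * i) + a (2 * i + 1) : ℕ)))
        = Real.exp (∑ i : Fin L, (-(ε / 2) +
          3 / (2 * Fintype.card V) * ((a (2 * i) + a (2 * i + 1) : ℕ) : ℝ)))
          * (Fintype.card V : ℝ) ^ L := by
      rw [Finset.prod_mul_distrib, Finset.prod_const, Finset.card_univ, Fintype.card_fin, mul_comm,
        Real.exp_sum]
    refine (h1.trans (h2.trans_eq h3)).trans ?_
    rw [Finset.sum_add_distrib, ← Finset.mul_sum, ← Nat.cast_sum, sum_range_two_mul]
    gcongr
    change _ + 3 / (2 * (Fintype.card V : ℝ)) * (blockFlips L e r : ℝ) ≤ _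
    -- The bound on the flips of the block gives back only half of the exponent `-ε L / 2`.
    have h4 : 3 / (2 * (Fintype.card V : ℝ)) * (blockFlips L e r : ℝ)
        ≤ 3 / (2 * (Fintype.card V : ℝ)) * (ε * Fintype.card V * L / 6) := by gcongr
    have h5 : 3 / (2 * (Fintype.card V : ℝ)) * (ε * Fintype.card V * L / 6) = ε * L / 4 := by
      field_simp; ring
    simp only [Finset.sum_const, Finset.card_univ, Fintype.card_fin, nsmul_eq_mul]
    linarith
  have hE : (E.card : ℝ) ≤ Fintype.card V ^ 2 := by
    have := Finset.card_filter_le (Finset.univ : Finset (V × V)) (fun p => G.Adj p.1 p.2)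
    rw [Finset.card_univ, Fintype.card_prod, ← sq] at this
    exact_mod_cast this
  calc ((Finset.univ.filter (fun σ : Fin L → M => Flawed φ L e r σ)).card : ℝ)
      ≤ ((E.biUnion bad).card : ℝ) := by exact_mod_cast Finset.card_le_card hsub
    _ ≤ ∑ p ∈ E, ((bad p).card : ℝ) := by exact_mod_cast Finset.card_biUnion_le
    _ ≤ E.card * (Real.exp (-(ε * L / 4)) * Fintype.card V ^ L) := by
      rw [← nsmul_eq_mul]; exact Finset.sum_le_card_nsmul _ _ _ hbad
    _ ≤ _ := by rw [mul_assoc]; gcongr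

/-- An event that is rare in each block happens in many blocks only with exponentially small
probability. -/
theorem card_many_events_le {Ω : Type*} [Fintype Ω] {R T : ℕ} (hR : R = 68 * T)
    (P : Fin R → Ω → Prop) [∀ r, DecidablePred (P r)]
    (hP : ∀ r, ((Finset.univ.filter (P r)).card : ℝ) ≤ Real.exp (-64) / 68 * Fintype.card Ω) :
    ((Finset.univ.filter (fun s : Fin R → Ω =>
        T < 32 * (Finset.univ.filter (fun r => P r (s r))).card)).card : ℝ)
      ≤ Real.exp (-T) * Fintype.card Ω ^ R := by
  -- Each event has weight `exp 64`, so more than `T / 32` events weigh at least `exp (2 T)`. The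
  -- mean weight of a block is at most `1 + 1 / 68 ≤ exp (1 / 68)`, which over `68 T` blocks gives
  -- only `exp T`.
  have h1 := mul_card_le_prod_sum (Finset.univ.filter (fun s : Fin R → Ω =>
        T < 32 * (Finset.univ.filter (fun r => P r (s r))).card))
    (fun r ω => if P r ω then Real.exp 64 else 1) (fun r ω => by split_ifs <;> positivity)
    (Real.exp (2 * T)) (fun s hs => by
      have hs := (Finset.mem_filter.1 hs).2
      rw [Finset.prod_ite, Finset.prod_const, Finset.prod_const_one, mul_one, ← Real.exp_nat_mul]
      apply Real.exp_le_exp.2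
      have : (T : ℝ) ≤ 32 * (Finset.univ.filter (fun r => P r (s r))).card := by
        exact_mod_cast hs.le
      linarith)
  have h2 : ∏ r : Fin R, ∑ ω, (if P r ω then Real.exp 64 else 1)
      ≤ ∏ _r : Fin R, (Real.exp (1 / 68) * (Fintype.card Ω : ℝ)) := by
    refine Finset.prod_le_prod (fun r _ => Finset.sum_nonneg fun ω _ => by
      split_ifs <;> positivity) fun r _ => ?_
    have h3 : ∀ ω, (if P r ω then Real.exp 64 else 1) ≤ 1 + (if P r ω then 1 else 0) * Real.exp 64 := by
      intro ω; split_ifs <;> simp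
    refine (Finset.sum_le_sum fun ω _ => h3 ω).trans ?_
    rw [Finset.sum_add_distrib, ← Finset.sum_mul, Finset.sum_boole]
    have h4 : ((Finset.univ.filter (P r)).card : ℝ) * Real.exp 64
        ≤ Real.exp (-64) / 68 * Fintype.card Ω * Real.exp 64 := by gcongr; exact hP r
    have h5 : Real.exp (-64) / 68 * Fintype.card Ω * Real.exp 64 = 1 / 68 * Fintype.card Ω := by
      rw [Real.exp_neg]; field_simp
    have h6 := mul_le_mul_of_nonneg_right (Real.add_one_le_exp (1 / 68))
      (Nat.cast_nonneg (α := ℝ) (Fintype.card Ω))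
    simp only [Finset.sum_const, Finset.card_univ, nsmul_eq_mul, mul_one]
    linarith
  have h3 : ∏ _r : Fin R, (Real.exp (1 / 68) * (Fintype.card Ω : ℝ))
      = Real.exp T * Fintype.card Ω ^ R := by
    rw [Finset.prod_const, Finset.card_univ, Fintype.card_fin, mul_pow, ← Real.exp_nat_mul, hR]
    congr 2
    push_cast; ring
  have h4 : Real.exp (2 * T) = Real.exp T * Real.exp T := by rw [← Real.exp_add]; ring_nf
  rw [h3] at h2
  have h5 := h1.trans h2
  rw [h4, mul_assoc] at h5
  have h6 := le_of_mul_le_mul_left h5 (Real.exp_pos _)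
  rw [Real.exp_neg, inv_mul_eq_div, le_div_iff₀ (Real.exp_pos _), mul_comm]
  exact h6

open Classical in
/-- For a fixed pattern of flips within the bit error rate, many blocks are flawed only for a few
of the shifts. -/
theorem card_flawed_seeds_le {ε : ℝ} (hε : 0 < ε) (hV : 0 < Fintype.card V)
    (hG : ∀ u v : V, G.Adj u v →
      ε * (Fintype.card V : ℝ) ≤ (Fintype.card (G.commonNeighbors u v) : ℝ))
    {L R T : ℕ} (hL : 0 < L) (hR : R = 68 * T)
    (hLexp : Fintype.card V ^ 2 * Real.exp (-(ε * L / 4)) ≤ Real.exp (-64) / 68)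
    (e : ℕ → G.Dart → Bool)
    (he : (∑ t ∈ Finset.range (R * (2 * L)), flipCount (e t) : ℕ)
      ≤ ε / 26112 / Fintype.card V * (Fintype.card G.Dart * ((R * (2 * L) : ℕ) : ℝ))) :
    ((Finset.univ.filter (fun s : Fin R → Fin L → M =>
        T < 16 * (Finset.univ.filter (fun r : Fin R => Flawed φ L e r (s r))).card)).card : ℝ)
      ≤ Real.exp (-T) * Fintype.card (Fin R → Fin L → M) := by
  have hn : (0 : ℝ) < Fintype.card V := by exact_mod_cast hV
  have hL' : (0 : ℝ) < L := by exact_mod_cast hL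
  let heavy : ℕ → Prop := fun r => ε * Fintype.card V * L / 6 < (blockFlips L e r : ℝ)
  -- The allowance of `T / 16` flawed blocks is split evenly between heavy and light ones. Here
  -- `26112 = 68 * 2 * 6 * 32`: the factors of the number of rounds, the threshold for heaviness,
  -- and the share `T / 32`.
  have hheavy : 32 * ((Finset.range R).filter heavy).card ≤ T := by
    have h1 : ((Finset.range R).filter heavy).card * (ε * Fintype.card V * L / 6)
        ≤ ∑ r ∈ Finset.range R, (blockFlips L e r : ℝ) := by
      rw [← nsmul_eq_mul]
      refine (Finset.card_nsmul_le_sum _ _ _ (fun r hr => ?_)).trans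
        (Finset.sum_le_sum_of_subset_of_nonneg (Finset.filter_subset heavy _)
          (fun r _ _ => Nat.cast_nonneg _))
      exact (Finset.mem_filter.1 hr).2.le
    rw [← Nat.cast_sum, sum_blockFlips] at h1
    have h2 : (Fintype.card G.Dart : ℝ) ≤ (Fintype.card V : ℝ) ^ 2 := by
      exact_mod_cast card_dart_le
    have h3 := h1.trans (he.trans (b := _) (c := ε / 26112 / Fintype.card V *
      ((Fintype.card V : ℝ) ^ 2 * ((R * (2 * L) : ℕ) : ℝ))) (by gcongr))
    have h4 : ε / 26112 / Fintype.card V * ((Fintype.card V : ℝ) ^ 2 * ((R * (2 * L) : ℕ) : ℝ))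
        = (T / 32 : ℝ) * (ε * Fintype.card V * L / 6) := by
      rw [hR]; push_cast; field_simp; ring
    rw [h4] at h3
    have h5 := le_of_mul_le_mul_right h3 (by positivity)
    have h6 : (32 : ℝ) * ((Finset.range R).filter heavy).card ≤ T := by linarith
    exact_mod_cast h6
  have hlight := card_many_events_le (Ω := Fin L → M) hR
    (fun r σ => ¬ heavy r ∧ Flawed φ L e r σ) (fun r => by
      by_cases hr : heavy r
      · simp only [hr, not_true, false_and, Finset.filter_false, Finset.card_empty, Nat.cast_zero]
        positivity
      · simp only [hr, not_false_iff, true_and]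
        refine (card_flawed_le φ hG e r (not_lt.1 hr)).trans ?_
        rw [Fintype.card_fun, Fintype.card_fin, ← Fintype.card_congr φ, Nat.cast_pow]
        gcongr)
  rw [Fintype.card_fun (α := Fin R), Fintype.card_fin, Nat.cast_pow]
  refine le_trans ?_ hlight
  rw [Nat.cast_le]
  refine Finset.card_le_card fun s hs => ?_
  have hs := (Finset.mem_filter.1 hs).2
  refine Finset.mem_filter.2 ⟨Finset.mem_univ _, ?_⟩
  have hcov : Finset.univ.filter (fun r : Fin R => Flawed φ L e r (s r)) ⊆
      Finset.univ.filter (fun r : Fin R => ¬ heavy r ∧ Flawed φ L e r (s r)) ∪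
      Finset.univ.filter (fun r : Fin R => heavy r) := by
    intro r hr
    have hr := (Finset.mem_filter.1 hr).2
    by_cases hh : heavy r <;> simp [hh, hr]
  have h1 := (Finset.card_le_card hcov).trans (Finset.card_union_le _ _)
  have h2 : (Finset.univ.filter (fun r : Fin R => heavy r)).card
      ≤ ((Finset.range R).filter heavy).card := by
    refine Finset.card_le_card_of_injOn (fun r => r.1) (fun r hr => ?_)
      Fin.val_injective.injOn
    exact Finset.mem_filter.2 ⟨Finset.mem_range.2 r.2, (Finset.mem_filter.1 hr).2⟩
  omega

end

end NoisyNetwork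

/-! ### One-time pads against the adaptive adversary. -/

namespace NoisyNetwork

section Padding

variable {V : Type*} {G : SimpleGraph V} {X Y : V → Type*} {R : ℕ}

/-- The protocol in which every transmitted bit is masked by a one-time pad. -/
def Protocol.padded (π : Protocol G X Y R) (P : ℕ → G.Dart → Bool) : Protocol G X Y R where
  send v a t h u :=
    xor (π.send v a t (fun s w => xor (h s w) (inbox v (P s) w)) u) (P t ⟨(v, u), u.2⟩)
  output v a h := π.output v a (fun s w => xor (h s w) (inbox v (P s) w))

/-- The received bits without the pads. -/
def Protocol.unpadded (π : Protocol G X Y R) (P : ℕ → G.Dart → Bool) (A : Adversary G X)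
    (x : ∀ v, X v) (t : ℕ) (d : G.Dart) : Bool :=
  xor ((π.padded P).received A x t d) (P t d)

/-- The flips of the adversary `A` that sees the bits `S`. -/
def flipsOf (A : Adversary G X) (x : ∀ v, X v) (S : ℕ → G.Dart → Bool) (t : ℕ) : G.Dart → Bool :=
  A x t (fun s => S s)

theorem flipsOf_congr {A : Adversary G X} {x : ∀ v, X v} {S S' : ℕ → G.Dart → Bool} {t : ℕ}
    (h : ∀ s ≤ t, S s = S' s) : flipsOf A x S t = flipsOf A x S' t := by
  unfold flipsOf
  congr 1
  funext s
  exact h s (Nat.lt_succ_iff.1 s.2)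

variable (π : Protocol G X Y R) (P : ℕ → G.Dart → Bool) (A : Adversary G X) (x : ∀ v, X v)

theorem Protocol.padded_sent (t : ℕ) (d : G.Dart) :
    (π.padded P).sent A x t d
      = xor (π.sendAll x t (fun s => π.unpadded P A x s) d) (P t d) := by
  rw [Protocol.sent_eq]
  rfl

theorem Protocol.unpadded_eq (t : ℕ) (d : G.Dart) :
    π.unpadded P A x t d = xor (π.sendAll x t (fun s => π.unpadded P A x s) d)
      (flipsOf A x ((π.padded P).sent A x) t d) := by
  rw [Protocol.unpadded, Protocol.received_eq, Protocol.padded_sent]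
  have : ∀ a b c : Bool, xor (xor (xor a b) c) b = xor a c := by decide
  exact this _ _ _

theorem Protocol.padded_result (v : V) :
    (π.padded P).result A x v
      = π.output v (x v) (fun s => inbox v (π.unpadded P A x s)) := rfl

theorem Protocol.padded_errorCount [Fintype V] [DecidableEq V] [DecidableRel G.Adj] :
    (π.padded P).errorCount A x
      = ∑ t ∈ Finset.range R, flipCount (flipsOf A x ((π.padded P).sent A x) t) := by
  refine Finset.sum_congr rfl fun t _ => congrArg Finset.card (Finset.filter_congr fun d _ => ?_)
  rw [Protocol.received_eq]
  have : ∀ a b : Bool, xor a b ≠ a ↔ b = true := by decide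
  exact this _ _

/-- The pads can be recovered from the transmitted bits. -/
theorem Protocol.pad_eq_of_sent_eq {P P' : ℕ → G.Dart → Bool}
    (h : ∀ t < R, (π.padded P).sent A x t = (π.padded P').sent A x t) :
    ∀ t < R, P t = P' t := by
  -- Equal transmitted bits provoke equal flips, so by induction on the round the unmasked
  -- executions agree; the pads are then their difference from the transmitted bits.
  have hclear : ∀ t < R, π.unpadded P A x t = π.unpadded P' A x t := by
    intro t
    induction t using Nat.strong_induction_on with
    | _ t ih =>
      intro ht
      funext d
      rw [π.unpadded_eq, π.unpadded_eq, flipsOf_congr (fun s hs => h s (by omega)),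
        funext fun s : Fin t => ih s s.2 (by omega)]
  intro t ht
  funext d
  have h1 := congrFun (h t ht) d
  rw [π.padded_sent, π.padded_sent, funext fun s : Fin t => hclear s (by omega)] at h1
  have : ∀ a b c : Bool, xor a b = xor a c → b = c := by decide
  exact this _ _ _ h1

end Padding

section Robust

variable {V : Type*} [Fintype V] {G : SimpleGraph V} [DecidableRel G.Adj] {X Y : V → Type*}
  {M : Type} [AddCommGroup M] [Fintype M]

/-- Shifts given by a finite table. -/
def shiftsOf {R L : ℕ} (s : Fin R → Fin L → M) (r i : ℕ) : M :=
  if h : r < R ∧ i < L then s ⟨r, h.1⟩ ⟨i, h.2⟩ else 0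

/-- Bits on all darts given by a finite table. -/
noncomputable def bitsOf {R : ℕ} (P : Fin R → Fin (Fintype.card G.Dart) → Bool) (t : ℕ)
    (d : G.Dart) : Bool :=
  if h : t < R then P ⟨t, h⟩ (Fintype.equivFin G.Dart d) else false

/-- The finite table of some bits on all darts. -/
noncomputable def tableOf (R : ℕ) (S : ℕ → G.Dart → Bool) :
    Fin R → Fin (Fintype.card G.Dart) → Bool :=
  fun t k => S t ((Fintype.equivFin G.Dart).symm k)

theorem bitsOf_tableOf {R : ℕ} (S : ℕ → G.Dart → Bool) {t : ℕ} (ht : t < R) :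
    bitsOf (tableOf R S) t = S t := by
  funext d
  simp [bitsOf, tableOf, ht]

theorem bitsOf_injective {R : ℕ} {P P' : Fin R → Fin (Fintype.card G.Dart) → Bool}
    (h : ∀ t < R, bitsOf P t = bitsOf P' t) : P = P' := by
  funext t k
  have := congrFun (h t t.2) ((Fintype.equivFin G.Dart).symm k)
  simpa [bitsOf] using this

/-- The protocol `π` with random routing and one-time pads. -/
noncomputable def Protocol.robust {R : ℕ} (π : Protocol G X Y R) (φ : V ≃ M) (L : ℕ) :
    SharedProtocol G X Y where
  rounds := R * (2 * L)
  -- Seeds live in `Type` whereas `V` may lie in any universe; hence pads are indexed by numbers of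
  -- darts and shifts lie in `M : Type`.
  Seed := (Fin R → Fin L → M) × (Fin (R * (2 * L)) → Fin (Fintype.card G.Dart) → Bool)
  fintypeSeed := by classical exact inferInstance
  run ω := (π.routed φ L (shiftsOf ω.1)).padded (bitsOf ω.2)

/-- An injective change of the second coordinate, followed by a bound for each value of it. -/
theorem card_le_of_fibers {A B : Type*} [Fintype A] [Fintype B] (S : Finset (A × B))
    (f : A → B → B) (hf : ∀ a, Function.Injective (f a)) (Q : A → B → Prop)
    (hS : ∀ p ∈ S, Q p.1 (f p.1 p.2)) (δ : ℝ)
    (hQ : open Classical in ∀ b, (∃ p ∈ S, f p.1 p.2 = b) →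
      ((Finset.univ.filter (fun a => Q a b)).card : ℝ) ≤ δ) (hδ : 0 ≤ δ) :
    (S.card : ℝ) ≤ δ * Fintype.card B := by
  classical
  let g : A × B → A × B := fun p => (p.1, f p.1 p.2)
  have hg : Function.Injective g := by
    rintro ⟨a, b⟩ ⟨a', b'⟩ h
    obtain ⟨h1, h2⟩ := Prod.mk.inj h
    simp only at h1 h2
    subst h1
    rw [hf a h2]
  have hcard : S.card = ∑ b : B, ((S.image g).filter (fun p => p.2 = b)).card := by
    rw [← Finset.card_image_of_injective S hg]
    exact Finset.card_eq_sum_card_fiberwise (fun _ _ => Finset.mem_coe.2 (Finset.mem_univ _))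
  have hfib : ∀ b : B, (((S.image g).filter (fun p => p.2 = b)).card : ℝ) ≤ δ := by
    intro b
    by_cases hb : ∃ p ∈ S, f p.1 p.2 = b
    · refine le_trans ?_ (hQ b hb)
      rw [Nat.cast_le]
      refine Finset.card_le_card_of_injOn (fun p => p.1) (fun p hp => ?_) ?_
      · obtain ⟨h1, h2⟩ := Finset.mem_filter.1 hp
        obtain ⟨q, hq, rfl⟩ := Finset.mem_image.1 h1
        refine Finset.mem_filter.2 ⟨Finset.mem_univ _, ?_⟩
        rw [← h2]
        exact hS q hq
      · intro p hp q hq h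
        exact Prod.ext h ((Finset.mem_filter.1 hp).2.trans (Finset.mem_filter.1 hq).2.symm)
    · rw [Finset.filter_eq_empty_iff.2]
      · simpa using hδ
      · intro p hp h
        obtain ⟨q, hq, rfl⟩ := Finset.mem_image.1 hp
        exact hb ⟨q, hq, h⟩
  rw [hcard, Nat.cast_sum]
  refine (Finset.sum_le_card_nsmul _ _ _ (fun b _ => hfib b)).trans (le_of_eq ?_)
  rw [nsmul_eq_mul, Finset.card_univ, mul_comm]

/-- The seed is reparametrised by shifts and transcript. Failure forces more than `T / 16` flawed
blocks under flips read off the transcript, so `card_flawed_seeds_le` applies to each transcript. -/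
theorem Protocol.robust_tolerates [DecidableEq V] {ε : ℝ} (hε : 0 < ε)
    (hV : 0 < Fintype.card V)
    (hG : ∀ u v : V, G.Adj u v →
      ε * (Fintype.card V : ℝ) ≤ (Fintype.card (G.commonNeighbors u v) : ℝ))
    {L T R : ℕ} (hL : 0 < L) (hR : R = 68 * T)
    (hLexp : Fintype.card V ^ 2 * Real.exp (-(ε * L / 4)) ≤ Real.exp (-64) / 68)
    (φ : V ≃ M) (π : Protocol G X Y T) (κ : Protocol G X Y R)
    (hκ : open Classical in ∀ (x : ∀ v, X v) (rec : ℕ → G.Dart → Bool),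
      16 * ((Finset.range R).filter (fun r =>
        rec r ≠ κ.sendAll x r (fun s => rec s))).card ≤ T → ∀ v,
      κ.output v (x v) (fun s => inbox v (rec s)) = π.result (noiseless G X) x v) :
    (κ.robust φ L).Tolerates π (ε / 26112 / Fintype.card V) (Real.exp (-T)) := by
  classical
  intro A x hA
  let f : (Fin R → Fin L → M) → (Fin (R * (2 * L)) → Fin (Fintype.card G.Dart) → Bool) →
      (Fin (R * (2 * L)) → Fin (Fintype.card G.Dart) → Bool) := fun s P =>
    tableOf _ (((κ.routed φ L (shiftsOf s)).padded (bitsOf P)).sent A x)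
  have hf : ∀ s, Function.Injective (f s) := by
    intro s P P' h
    refine bitsOf_injective ((κ.routed φ L (shiftsOf s)).pad_eq_of_sent_eq A x fun t ht => ?_)
    exact (bitsOf_tableOf _ ht).symm.trans
      ((congrArg (fun S => bitsOf S t) h).trans (bitsOf_tableOf _ ht))
  have hflips : ∀ s P, ∀ t < R * (2 * L), flipsOf A x (bitsOf (f s P)) t
      = flipsOf A x (((κ.routed φ L (shiftsOf s)).padded (bitsOf P)).sent A x) t :=
    fun s P t ht => flipsOf_congr fun t' ht' => bitsOf_tableOf _ (by omega)
  let Q : (Fin R → Fin L → M) → (Fin (R * (2 * L)) → Fin (Fintype.card G.Dart) → Bool) → Prop :=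
    fun s S => T < 16 * (Finset.univ.filter (fun r : Fin R =>
      Flawed φ L (flipsOf A x (bitsOf S)) r (s r))).card
  let fail : Finset ((Fin R → Fin L → M) ×
      (Fin (R * (2 * L)) → Fin (Fintype.card G.Dart) → Bool)) :=
    Finset.univ.filter (fun ω => ((κ.robust φ L).run ω).result A x ≠ π.result (noiseless G X) x)
  have hfail : ∀ p ∈ fail, Q p.1 (f p.1 p.2) := by
    rintro ⟨s, P⟩ hp
    by_contra hQ
    refine (Finset.mem_filter.1 hp).2 (funext fun v => ?_)
    set rec := (κ.routed φ L (shiftsOf s)).unpadded (bitsOf P) A x with hrec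
    have hcor := κ.card_corrupted_le (φ := φ) (L := L) (s := shiftsOf s) rec
      (flipsOf A x (bitsOf (f s P))) x (fun t ht d => by
        rw [hflips s P t ht]
        exact Protocol.unpadded_eq _ _ _ _ _ _)
    have hcount : ((Finset.range R).filter (fun r =>
        Flawed φ L (flipsOf A x (bitsOf (f s P))) r (fun i => shiftsOf s r i))).card
        ≤ (Finset.univ.filter (fun r : Fin R =>
          Flawed φ L (flipsOf A x (bitsOf (f s P))) r (s r))).card := by
      refine le_trans (Finset.card_le_card (fun r hr => ?_)) (Finset.card_image_le (f := Fin.val))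
      obtain ⟨h1, h2⟩ := Finset.mem_filter.1 hr
      have hrR := Finset.mem_range.1 h1
      refine Finset.mem_image.2 ⟨⟨r, hrR⟩, Finset.mem_filter.2 ⟨Finset.mem_univ _, ?_⟩, rfl⟩
      have : (fun i : Fin L => shiftsOf s r i) = s ⟨r, hrR⟩ := by
        funext i; simp [shiftsOf, hrR]
      rwa [this] at h2
    have h16 : 16 * ((Finset.range R).filter (fun r => acceptedAll φ L (shiftsOf s) rec r
        ≠ κ.sendAll x r (fun r' => acceptedAll φ L (shiftsOf s) rec r'))).card ≤ T := by
      refine le_trans (Nat.mul_le_mul_left _ (le_trans (le_of_eq ?_) (hcor.trans hcount)))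
        (not_lt.1 hQ)
      congr
    rw [← hκ x _ (by convert h16) v, ← Protocol.routed_output]
    exact Protocol.padded_result _ _ _ _ _
  have hQ : ∀ S, (∃ p ∈ fail, f p.1 p.2 = S) →
      ((Finset.univ.filter (fun s => Q s S)).card : ℝ)
        ≤ Real.exp (-T) * Fintype.card (Fin R → Fin L → M) := by
    -- Only a transcript that occurs for some seed is known to respect the error rate. Its flips are
    -- the same for all shifts, so the bound obtained from that one seed serves for every shift.
    rintro _ ⟨⟨s, P⟩, -, rfl⟩
    refine card_flawed_seeds_le φ hε hV hG hL hR hLexp _ ?_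
    have h1 := hA (s, P)
    change ((((κ.routed φ L (shiftsOf s)).padded (bitsOf P)).errorCount A x : ℕ) : ℝ) ≤ _ at h1
    rw [Protocol.padded_errorCount] at h1
    rw [Finset.sum_congr rfl (fun t ht => by rw [hflips s P t (Finset.mem_range.1 ht)])]
    exact h1
  have hcard := card_le_of_fibers fail f hf Q hfail _ (by convert hQ) (by positivity)
  have hseed : (0 : ℝ) < Fintype.card ((Fin R → Fin L → M) ×
      (Fin (R * (2 * L)) → Fin (Fintype.card G.Dart) → Bool)) := by
    exact_mod_cast Fintype.card_pos
  have hgoal : (fail.card : ℝ) / Fintype.card ((Fin R → Fin L → M) ×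
      (Fin (R * (2 * L)) → Fin (Fintype.card G.Dart) → Bool)) ≤ Real.exp (-T) := by
    rw [div_le_iff₀ hseed, Fintype.card_prod, Nat.cast_mul]
    exact hcard.trans_eq (mul_assoc _ _ _)
  unfold SharedProtocol.failureProb
  convert hgoal using 1
  congr 2
  exact congrArg Finset.card (@Finset.filter_congr_decidable _ _ _ _ _)

end Robust

end NoisyNetwork

/-! ### Choice of the constants and conclusion. -/

namespace NoisyNetwork

variable {V : Type*} {G : SimpleGraph V} {X Y : V → Type*} {T : ℕ}

/-- The prime `65537` is large enough for the tree code, and its residues fit into `17` bits. -/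
theorem exists_scheme (N : ℕ) : ∃ (F : Type) (_ : Field F) (c : Scheme F),
    Function.Injective c.symbol ∧ Function.Injective c.code ∧
    ∀ σ τ : ℕ → Move Bool, c.symbol (σ 0) ≠ c.symbol (τ 0) → ∀ ℓ, 1 ≤ ℓ → ℓ ≤ N →
      ∀ S ⊆ Finset.range ℓ,
        (∀ k ∈ S, conv c.coeff (fun i => c.symbol (σ i) - c.symbol (τ i)) k = 0) →
          2 * S.card < ℓ := by
  have : Fact (Nat.Prime 65537) := ⟨by norm_num⟩
  have hA : Fintype.card (Move Bool) = 4 := by simp [Move]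
  obtain ⟨ι⟩ : Nonempty (Move Bool ↪ ZMod 65537) :=
    Function.Embedding.nonempty_of_card_le (by rw [hA, ZMod.card]; norm_num)
  obtain ⟨code⟩ : Nonempty (ZMod 65537 ↪ (Fin 17 → Bool)) :=
    Function.Embedding.nonempty_of_card_le (by
      rw [ZMod.card, Fintype.card_fun, Fintype.card_fin, Fintype.card_bool]; norm_num)
  obtain ⟨g, hg⟩ := exists_treeCode (F := ZMod 65537) (by rw [ZMod.card]; norm_num) hA ι N
  exact ⟨ZMod 65537, inferInstance, ⟨ι, g, code⟩, ι.injective, code.injective, hg⟩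

/-- The sequence `rec` is arbitrary and not tied to an adversary, so that it can be the bits
accepted by majority in the routed protocol. -/
theorem exists_coded (π : Protocol G X Y T) : ∃ κ : Protocol G X Y (4 * T * 17),
    open Classical in ∀ (x : ∀ v, X v) (rec : ℕ → G.Dart → Bool),
      16 * ((Finset.range (4 * T * 17)).filter (fun r =>
        rec r ≠ κ.sendAll x r (fun s => rec s))).card ≤ T → ∀ v,
      κ.output v (x v) (fun s => inbox v (rec s)) = π.result (noiseless G X) x v := by
  obtain ⟨F, _, c, h1, h2, h3⟩ := exists_scheme (4 * T)
  exact ⟨π.coded c (4 * T), fun x rec hrec v => π.coded_output h1 h2 h3 x rec hrec v⟩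

/-- Since `808 = 4 * 202`, the exponent is at most `-200 * log n`. It also has to absorb `64 + 68`,
which it does because `200 * log 2 > 132`. -/
theorem sq_mul_exp_le {ε n L : ℝ} (hε : 0 < ε) (hn : 2 ≤ n) (hL : 808 / ε * Real.log n ≤ L) :
    n ^ 2 * Real.exp (-(ε * L / 4)) ≤ Real.exp (-64) / 68 := by
  have hlog : Real.log 2 ≤ Real.log n := Real.log_le_log (by norm_num) hn
  have hlog2 := Real.log_two_gt_d9
  have h1 : 202 * Real.log n ≤ ε * L / 4 := by
    have := mul_le_mul_of_nonneg_left hL hε.le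
    rw [← mul_assoc, mul_div_cancel₀ _ hε.ne'] at this
    linarith
  have h2 : n ^ 2 = Real.exp (2 * Real.log n) := by
    rw [two_mul, Real.exp_add, Real.exp_log (by linarith), sq]
  have h3 : (68 : ℝ) ≤ Real.exp 68 := by linarith [Real.add_one_le_exp (68 : ℝ)]
  rw [h2, ← Real.exp_add, le_div_iff₀ (by norm_num)]
  calc Real.exp (2 * Real.log n + -(ε * L / 4)) * 68
      ≤ Real.exp (2 * Real.log n + -(ε * L / 4)) * Real.exp 68 := by gcongr
    _ = Real.exp (2 * Real.log n + -(ε * L / 4) + 68) := (Real.exp_add _ _).symm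
    _ ≤ Real.exp (-64) := Real.exp_le_exp.2 (by linarith)

theorem exists_robust [Fintype V] [DecidableEq V] [DecidableRel G.Adj] {ε : ℝ} (hε : 0 < ε)
    (hV : 2 ≤ Fintype.card V)
    (hG : ∀ u v : V, G.Adj u v →
      ε * (Fintype.card V : ℝ) ≤ (Fintype.card (G.commonNeighbors u v) : ℝ))
    (π : Protocol G X Y T) : ∃ σ : SharedProtocol G X Y,
      (σ.rounds : ℝ) ≤ 136 * (808 / ε + 2) * (T * Real.log (Fintype.card V)) ∧
      σ.Tolerates π (ε / 26112 / Fintype.card V) (Real.exp (-T)) := by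
  have hn : (2 : ℝ) ≤ Fintype.card V := by exact_mod_cast hV
  have hlog : Real.log 2 ≤ Real.log (Fintype.card V) := Real.log_le_log (by norm_num) hn
  have hlog2 := Real.log_two_gt_d9
  obtain ⟨κ, hκ⟩ := exists_coded π
  set L := ⌈808 / ε * Real.log (Fintype.card V)⌉₊ with hL
  have hpos : 0 < 808 / ε * Real.log (Fintype.card V) := by
    have : 0 < Real.log (Fintype.card V) := by linarith
    positivity
  -- Rounding up costs at most `1 ≤ 2 * log n`, as `n ≥ 2`.
  have hLle : (L : ℝ) ≤ (808 / ε + 2) * Real.log (Fintype.card V) := by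
    have := (Nat.ceil_lt_add_one hpos.le).le
    rw [add_mul]
    linarith
  have : NeZero (Fintype.card V) := ⟨by omega⟩
  -- Any group structure on the vertices will do for the shifts.
  have φ : V ≃ ZMod (Fintype.card V) := Fintype.equivOfCardEq (ZMod.card _).symm
  refine ⟨κ.robust φ L, ?_, Protocol.robust_tolerates hε (by omega) hG (Nat.ceil_pos.2 hpos)
    (by ring) (sq_mul_exp_le hε hn (Nat.le_ceil _)) φ π κ (by convert hκ)⟩
  change ((4 * T * 17 * (2 * L) : ℕ) : ℝ) ≤ _
  push_cast
  calc (4 * T * 17 * (2 * L) : ℝ) = 136 * T * L := by ring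
    _ ≤ 136 * T * ((808 / ε + 2) * Real.log (Fintype.card V)) := by gcongr
    _ = _ := by ring

/-- Without edges no communication is needed. -/
theorem exists_robust_of_isEmpty [Fintype V] [DecidableEq V] [DecidableRel G.Adj]
    (hG : ∀ u v, ¬ G.Adj u v) (π : Protocol G X Y T) (ρ δ : ℝ) (hδ : 0 ≤ δ) :
    ∃ σ : SharedProtocol G X Y, σ.rounds = 0 ∧ σ.Tolerates π ρ δ := by
  let κ : Protocol G X Y 0 :=
    { send := fun _ _ _ _ _ => false
      output := fun v a _ => π.output v a (fun _ _ => false) }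
  refine ⟨⟨0, Unit, fun _ => κ⟩, rfl, fun A x _ => ?_⟩
  have : κ.result A x = π.result (noiseless G X) x := by
    funext v
    simp only [Protocol.result, κ]
    congr 1
    funext s w
    exact absurd w.2 (hG v w)
  unfold SharedProtocol.failureProb
  simpa [this] using hδ

end NoisyNetwork

open NoisyNetwork in
theorem mainTheorem10 (ε : ℝ) (hε : 0 < ε) :
    ∃ ρ c K : ℝ, 0 < ρ ∧ 0 < c ∧ 0 < K ∧
      ∀ (V : Type*) [Fintype V] [DecidableEq V] (G : SimpleGraph V) [DecidableRel G.Adj],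
        (∀ u v : V, G.Adj u v →
          ε * (Fintype.card V : ℝ) ≤ (Fintype.card (G.commonNeighbors u v) : ℝ)) →
        ∃ C : SharedCompiler G,
          ∀ (X Y : V → Type*) (T : ℕ) (π : Protocol G X Y T),
            ((C X Y T π).rounds : ℝ) ≤ K * ((T : ℝ) * Real.log (Fintype.card V)) ∧
            (C X Y T π).Tolerates π (ρ / (Fintype.card V : ℝ)) (Real.exp (-(c * (T : ℝ)))) := by
  refine ⟨ε / 26112, 1, 136 * (808 / ε + 2), by positivity, one_pos, by positivity, ?_⟩
  intro V _ _ G _ hG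
  have H : ∀ (X : V → Type _) (Y : V → Type _) (T : ℕ) (π : Protocol G X Y T),
      ∃ σ : SharedProtocol G X Y,
        (σ.rounds : ℝ) ≤ 136 * (808 / ε + 2) * (T * Real.log (Fintype.card V)) ∧
        σ.Tolerates π (ε / 26112 / Fintype.card V) (Real.exp (-(1 * (T : ℝ)))) := by
    intro X Y T π
    rw [one_mul]
    -- For `n ≤ 1` the logarithm vanishes and no round is allowed, but there are no edges either.
    rcases Nat.lt_or_ge (Fintype.card V) 2 with hV | hV
    · have hsub : Subsingleton V := Fintype.card_le_one_iff_subsingleton.1 (by omega)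
      obtain ⟨σ, h1, h2⟩ := exists_robust_of_isEmpty
        (fun u v h => h.ne (Subsingleton.elim u v)) π
        (ε / 26112 / Fintype.card V) (Real.exp (-T)) (Real.exp_pos _).le
      refine ⟨σ, ?_, h2⟩
      rw [h1, Nat.cast_zero]
      have := Real.log_natCast_nonneg (Fintype.card V)
      positivity
    · exact exists_robust hε hV hG π
  choose C hC using H
  exact ⟨C, fun X Y T π => hC X Y T π⟩
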